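/- Let $k\ge 1$ be an integer, let $q=e^{2\pi i/k}$, and let $A_k=\{rq^s : r\ge 0,\ s\in\mathbb{N}\}\subset\mathbb{C}$. A Borel probability measure $\mu$ on $\mathbb{C}$ is called $k$-symmetric if it is concentrated on $A_k$ and $\mu(qB)=\mu(B)$ for every Borel set $B\subset\mathbb{C}$; it has all moments if $\int_{\mathbb{C}}|z|^n\,\mu(dz)<\infty$ for all $n\ge 1$. In that case put $m_n(\mu)=\int_{\mathbb{C}}z^n\,\mu(dz)$ and let the free cumulants $(\kappa_n(\mu))_{n\ge1}$ be the complex numbers determined recursively by $$m_n(\mu)=\sum_{\pi\in NC(n)}\ \prod_{V\in\pi}\kappa_{|V|}(\mu)\qquad(n\ge 1),$$ where $NC(n)$ is the set of non-crossing partitions of $\{1,\dots,n\}$. **Theorem.** Let $\mu$ be a $k$-symmetric probability measure with all moments. Then for every real $t>1$ there exists a $k$-symmetric probability measure $\mu^{\boxplus t}$ with all moments such that $$\kappa_n(\mu^{\boxplus t})=t\,\kappa_n(\mu)\qquad\text{for all } n\ge 1.$$ -/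

import Mathlib

open MeasureTheory

noncomputable section

/-- The closed `k`-semiaxes: the points `r * q ^ s` with `r ≥ 0` and `s ∈ ℕ`, where
`q = exp (2πi / k)` is a primitive `k`-th root of unity. -/
def kSemiaxes (k : ℕ) : Set ℂ :=
  {z | ∃ r : ℝ, 0 ≤ r ∧ ∃ s : ℕ, z = (r : ℂ) * Complex.exp (2 * Real.pi * Complex.I / k) ^ s}

/-- A `k`-symmetric distribution: a Borel probability measure on `ℂ` which is concentrated on the
`k`-semiaxes and satisfies `μ (q B) = μ B` for every Borel set `B`, with `q = exp (2πi / k)`. -/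
structure IsKSymmetric (k : ℕ) (μ : Measure ℂ) : Prop where
  isProbabilityMeasure : IsProbabilityMeasure μ
  compl_kSemiaxes : μ (kSemiaxes k)ᶜ = 0
  rotation_invariant : ∀ B : Set ℂ, MeasurableSet B →
    μ ((fun z : ℂ => Complex.exp (2 * Real.pi * Complex.I / k) * z) '' B) = μ B

/-- All absolute moments of `μ` are finite. -/
def HasAllMoments (μ : Measure ℂ) : Prop :=
  ∀ n : ℕ, Integrable (fun z : ℂ => ‖z‖ ^ n) μ

/-- The `n`-th moment `∫ z ^ n dμ` of `μ`. -/
def moment (μ : Measure ℂ) (n : ℕ) : ℂ := ∫ z : ℂ, z ^ n ∂μ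

/-- Partitions of the `n`-element linearly ordered set `Fin n`. -/
abbrev SetPartition (n : ℕ) : Type := Finpartition (Finset.univ : Finset (Fin n))

/-- No two distinct blocks `V`, `W` contain points `a, c ∈ V`, `b, d ∈ W` with `a < b < c < d`. -/
def IsNonCrossing {n : ℕ} (π : SetPartition n) : Prop :=
  ∀ V ∈ π.parts, ∀ W ∈ π.parts, ∀ a b c d : Fin n,
    a < b → b < c → c < d → a ∈ V → c ∈ V → b ∈ W → d ∈ W → V = W

open Classical in
/-- The finite set `NC(n)` of non-crossing partitions of an `n`-element ordered set. -/
def NC (n : ℕ) : Finset (SetPartition n) := Finset.univ.filter IsNonCrossing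

open Classical in
/-- The free cumulants `κ n` of a moment sequence `m`, defined by solving the moment-cumulant
formula `m n = ∑ π ∈ NC n, ∏ V ∈ π.parts, κ V.card` recursively for the term of the partition with
one block: the sum below runs over the non-crossing partitions all of whose blocks have fewer than
`n` elements (so the condition `V.card < n` under the product always holds). -/
def freeCumulantOfMoments (m : ℕ → ℂ) (n : ℕ) : ℂ :=
  m n - ∑ π ∈ (NC n).filter (fun π => ∀ V ∈ π.parts, V.card < n),
    ∏ V ∈ π.parts, if V.card < n then freeCumulantOfMoments m V.card else 0
termination_by n

/-- The `n`-th free cumulant of `μ`. -/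
def freeCumulant (μ : Measure ℂ) (n : ℕ) : ℂ := freeCumulantOfMoments (moment μ) n

/-- The moment-cumulant formula. -/
theorem moment_eq_sum_freeCumulantOfMoments (m : ℕ → ℂ) (n : ℕ) (hn : 1 ≤ n) :
    m n = ∑ π ∈ NC n, ∏ V ∈ π.parts, freeCumulantOfMoments m V.card := by
  classical
  have hne : (Finset.univ : Finset (Fin n)) ≠ ⊥ := by
    have : Nonempty (Fin n) := ⟨⟨0, hn⟩⟩
    simpa using Finset.univ_nonempty.ne_empty
  have hsplit := Finset.sum_filter_add_sum_filter_not (NC n)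
    (fun π : SetPartition n => ∀ V ∈ π.parts, V.card < n)
    (fun π => ∏ V ∈ π.parts, freeCumulantOfMoments m V.card)
  have htop : (NC n).filter (fun π : SetPartition n => ¬ ∀ V ∈ π.parts, V.card < n)
      = {Finpartition.indiscrete hne} := by
    ext π
    simp only [NC, Finset.mem_filter, Finset.mem_univ, true_and, Finset.mem_singleton]
    constructor
    · rintro ⟨-, h⟩
      push Not at h
      obtain ⟨V, hV, hc⟩ := h
      have hVu : V = Finset.univ := by
        apply Finset.eq_univ_of_card
        have := Finset.card_le_univ V
        simp at this ⊢
        omega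
      ext W
      simp only [Finpartition.indiscrete_parts, Finset.mem_singleton]
      constructor
      · intro hW
        obtain ⟨x, hx⟩ := π.nonempty_of_mem_parts hW
        rw [← hVu]
        exact π.eq_of_mem_parts hW hV hx (hVu ▸ Finset.mem_univ x)
      · rintro rfl
        exact hVu ▸ hV
    · rintro rfl
      refine ⟨?_, ?_⟩
      · intro V hV W hW
        simp only [Finpartition.indiscrete_parts, Finset.mem_singleton] at hV hW
        intros
        rw [hV, hW]
      · intro h
        have := h Finset.univ (by simp)
        simp at this
  rw [htop] at hsplit
  rw [← hsplit]
  simp only [Finset.sum_singleton, Finpartition.indiscrete_parts, Finset.prod_singleton,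
    Finset.card_univ, Fintype.card_fin]
  conv_rhs => rw [freeCumulantOfMoments.eq_1 m n]
  have : ∀ π ∈ (NC n).filter (fun π : SetPartition n => ∀ V ∈ π.parts, V.card < n),
      (∏ V ∈ π.parts, if V.card < n then freeCumulantOfMoments m V.card else 0)
        = ∏ V ∈ π.parts, freeCumulantOfMoments m V.card := by
    intro π hπ
    refine Finset.prod_congr rfl fun V hV => ?_
    rw [if_pos ((Finset.mem_filter.1 hπ).2 V hV)]
  rw [Finset.sum_congr rfl this]
  ring

end

/-! By rotation invariance the moments of `μ` vanish unless `k ∣ n`, and the remaining ones are the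
moments of the image of `μ` under `z ↦ z ^ k`, a measure on `[0, ∞)`. The theorem thus concerns the
Stieltjes moment series `P = ∑ m_{kn} X ^ n`.

Algebra. Moments and free cumulants are tied by `M(z) = C(z M(z))` (`mk_ncSum_eq_subst`). Write `P =
1 / (1 - X B)`, let `G` solve `G = 1 + (t - 1) X G ^ k B(X G ^ k)`, and put `p = P(X G ^ k)`. Then
`p (t - G) = t - 1`, so `Q = G p` also equals `1 + t (p - 1)`. Since `P(z ^ k) = M(z)`, the first
form gives `p(z ^ k) = M(z G(z ^ k)) = C(z Q(z ^ k))`, and the second then says that `Q(z ^ k)` has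
the cumulants of `M` multiplied by `t` (`freeCumulantOfMoments_power`).

Positivity. A series is Stieltjes when the divided differences `(f(x) - f(y)) / (x - y)` of `X f`
and of `f` are positive semidefinite kernels. Such kernels are stable under sums, products and
substitutions, so identities between divided differences show that the Stieltjes property passes
between `B` and `1 / (1 - X B)` in both directions, and from `B` to the solution of `G = (1 + X B)(X
G)` (`IsStieltjes.of_subst`). Iterating the latter `k` times yields the `G` above, and `1 / G = 1 -
X B₁` gives `1 / Q = 1 - X (t / (t - 1)) B₁`, so `Q` is Stieltjes (`IsStieltjes.exists_power`).

Analysis. The Stieltjes moment problem (`IsStieltjes.exists_measure`) turns `Q` into a measure on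
`[0, ∞)`; spreading its `k`-th roots evenly over the semiaxes gives the desired measure. -/

/-- Power series in two variables, regarded as generating functions of infinite matrices. -/
abbrev Kernel : Type := MvPowerSeries (Fin 2) ℝ

/-! ### Positive semidefinite kernels as two-variable power series -/

namespace Kernel

open MvPowerSeries

/-- The embedding `f ↦ f(x)`. -/
noncomputable def inX : PowerSeries ℝ →ₐ[ℝ] Kernel :=
  PowerSeries.substAlgHom (PowerSeries.HasSubst.X (0 : Fin 2))

/-- The embedding `f ↦ f(y)`. -/
noncomputable def inY : PowerSeries ℝ →ₐ[ℝ] Kernel :=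
  PowerSeries.substAlgHom (PowerSeries.HasSubst.X (1 : Fin 2))

theorem inX_apply (f : PowerSeries ℝ) : inX f = f.subst (X 0 : Kernel) := by
  rw [inX, PowerSeries.coe_substAlgHom]

theorem inY_apply (f : PowerSeries ℝ) : inY f = f.subst (X 1 : Kernel) := by
  rw [inY, PowerSeries.coe_substAlgHom]

theorem eq_single_zero_iff (e : Fin 2 →₀ ℕ) : e = Finsupp.single 0 (e 0) ↔ e 1 = 0 := by
  constructor
  · intro h
    rw [h]
    simp
  · intro h
    ext i
    fin_cases i <;> simp [h]

theorem eq_single_one_iff (e : Fin 2 →₀ ℕ) : e = Finsupp.single 1 (e 1) ↔ e 0 = 0 := by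
  constructor
  · intro h
    rw [h]
    simp
  · intro h
    ext i
    fin_cases i <;> simp [h]

theorem coeff_inX (f : PowerSeries ℝ) (e : Fin 2 →₀ ℕ) :
    coeff e (inX f) = if e 1 = 0 then PowerSeries.coeff (e 0) f else 0 := by
  rw [inX_apply, PowerSeries.coeff_subst_single]
  simp only [eq_single_zero_iff]

theorem coeff_inY (f : PowerSeries ℝ) (e : Fin 2 →₀ ℕ) :
    coeff e (inY f) = if e 0 = 0 then PowerSeries.coeff (e 1) f else 0 := by
  rw [inY_apply, PowerSeries.coeff_subst_single]
  simp only [eq_single_one_iff]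

theorem coeff_inX_mul_inY (f g : PowerSeries ℝ) (e : Fin 2 →₀ ℕ) :
    coeff e (inX f * inY g) = PowerSeries.coeff (e 0) f * PowerSeries.coeff (e 1) g := by
  rw [coeff_mul, Finset.sum_eq_single (Finsupp.single 0 (e 0), Finsupp.single 1 (e 1))]
  · simp [coeff_inX, coeff_inY]
  · rintro ⟨p, q⟩ h hne
    rw [Finset.HasAntidiagonal.mem_antidiagonal] at h
    simp only [coeff_inX, coeff_inY]
    by_cases hp : p 1 = 0
    · by_cases hq : q 0 = 0
      · exfalso
        apply hne
        have h0 : p 0 + q 0 = e 0 := by rw [← h]; rfl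
        have h1 : p 1 + q 1 = e 1 := by rw [← h]; rfl
        rw [Prod.mk.injEq]
        constructor <;> ext i <;> fin_cases i <;> simp <;> omega
      · simp [hq]
    · simp [hp]
  · intro h
    exfalso
    apply h
    rw [Finset.HasAntidiagonal.mem_antidiagonal]
    ext i
    fin_cases i <;> simp

/-- Two kernels agree in all entries with indices below `N`. -/
def AgreeBelow (N : ℕ) (K L : Kernel) : Prop :=
  ∀ e : Fin 2 →₀ ℕ, e 0 < N → e 1 < N → coeff e K = coeff e L

theorem AgreeBelow.mul {N : ℕ} {K K' L L' : Kernel} (h : AgreeBelow N K K')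
    (h' : AgreeBelow N L L') : AgreeBelow N (K * L) (K' * L') := by
  intro e h0 h1
  rw [coeff_mul, coeff_mul]
  refine Finset.sum_congr rfl fun p hp => ?_
  rw [Finset.HasAntidiagonal.mem_antidiagonal] at hp
  have e0 : p.1 0 + p.2 0 = e 0 := by rw [← hp]; rfl
  have e1 : p.1 1 + p.2 1 = e 1 := by rw [← hp]; rfl
  rw [h p.1 (by omega) (by omega), h' p.2 (by omega) (by omega)]

/-- The kernel `∑ f_l(x) f_l(y)` of a finite family. -/
noncomputable def gram {ι : Type} [Fintype ι] (f : ι → PowerSeries ℝ) : Kernel :=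
  ∑ l, inX (f l) * inY (f l)

theorem coeff_gram {ι : Type} [Fintype ι] (f : ι → PowerSeries ℝ) (e : Fin 2 →₀ ℕ) :
    coeff e (gram f) = ∑ l, PowerSeries.coeff (e 0) (f l) * PowerSeries.coeff (e 1) (f l) := by
  simp only [gram, map_sum, coeff_inX_mul_inY]

/-- All finite sections of the matrix are Gram matrices. -/
def IsPSD (K : Kernel) : Prop :=
  ∀ N : ℕ, ∃ (ι : Type) (_ : Fintype ι) (f : ι → PowerSeries ℝ), AgreeBelow N K (gram f)

theorem isPSD_of_agreeBelow {K : Kernel} (h : ∀ N, ∃ L, IsPSD L ∧ AgreeBelow N K L) :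
    IsPSD K := by
  intro N
  obtain ⟨L, hL, hKL⟩ := h N
  obtain ⟨ι, hι, f, hf⟩ := hL N
  exact ⟨ι, hι, f, fun e h0 h1 => (hKL e h0 h1).trans (hf e h0 h1)⟩

theorem isPSD_rankOne (f : PowerSeries ℝ) : IsPSD (inX f * inY f) := fun N =>
  ⟨Unit, inferInstance, fun _ => f, fun e _ _ => by simp [gram]⟩

theorem isPSD_one : IsPSD 1 := by
  simpa using isPSD_rankOne 1

theorem isPSD_zero : IsPSD 0 := by
  simpa using isPSD_rankOne 0

theorem IsPSD.add {K L : Kernel} (hK : IsPSD K) (hL : IsPSD L) : IsPSD (K + L) := by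
  intro N
  obtain ⟨ι, hι, f, hf⟩ := hK N
  obtain ⟨ι', hι', g, hg⟩ := hL N
  refine ⟨ι ⊕ ι', inferInstance, Sum.elim f g, fun e h0 h1 => ?_⟩
  simp [map_add, hf e h0 h1, hg e h0 h1, gram]

/-- The product is that of power series, not the entrywise one: `f(x) f(y) · g(x) g(y)` is the
rank-one kernel of `f g`. Finite sections suffice because a coefficient of a product only involves
smaller indices. -/
theorem IsPSD.mul {K L : Kernel} (hK : IsPSD K) (hL : IsPSD L) : IsPSD (K * L) := by
  intro N
  obtain ⟨ι, hι, f, hf⟩ := hK N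
  obtain ⟨ι', hι', g, hg⟩ := hL N
  refine ⟨ι × ι', inferInstance, fun l => f l.1 * g l.2, fun e h0 h1 => ?_⟩
  rw [hf.mul hg e h0 h1]
  congr 1
  simp only [gram, Fintype.sum_mul_sum, Fintype.sum_prod_type, map_mul]
  refine Finset.sum_congr rfl fun _ _ => Finset.sum_congr rfl fun _ _ => by ring

theorem IsPSD.pow {K : Kernel} (hK : IsPSD K) (n : ℕ) : IsPSD (K ^ n) := by
  induction n with
  | zero => simpa using isPSD_one
  | succ n ih => rw [pow_succ]; exact ih.mul hK

theorem isPSD_sum {ι : Type*} (s : Finset ι) (K : ι → Kernel) (h : ∀ i ∈ s, IsPSD (K i)) :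
    IsPSD (∑ i ∈ s, K i) := by
  classical
  induction s using Finset.induction_on with
  | empty => simpa using isPSD_zero
  | insert a s ha ih =>
    rw [Finset.sum_insert ha]
    exact (h a (by simp)).add (ih fun i hi => h i (by simp [hi]))

theorem coeff_inX_mul_inY_mul_eq_zero {N : ℕ} {U V : PowerSeries ℝ} (hU : PowerSeries.X ^ N ∣ U)
    (K : Kernel) (e : Fin 2 →₀ ℕ) (he : e 0 < N ∨ e 1 < N) (hV : PowerSeries.X ^ N ∣ V) :
    coeff e (inX U * inY V * K) = 0 := by
  rw [coeff_mul]
  refine Finset.sum_eq_zero fun p hp => ?_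
  rw [Finset.HasAntidiagonal.mem_antidiagonal] at hp
  have e0 : p.1 0 + p.2 0 = e 0 := by rw [← hp]; rfl
  have e1 : p.1 1 + p.2 1 = e 1 := by rw [← hp]; rfl
  rw [coeff_inX_mul_inY]
  rw [PowerSeries.X_pow_dvd_iff] at hU hV
  rcases he with he | he
  · rw [hU (p.1 0) (by omega)]; simp
  · rw [hV (p.1 1) (by omega)]; simp

theorem X_pow_dvd_pow {U : PowerSeries ℝ} (hU : PowerSeries.constantCoeff U = 0) (n : ℕ) :
    PowerSeries.X ^ n ∣ U ^ n :=
  pow_dvd_pow_of_dvd (PowerSeries.X_dvd_iff.2 hU) n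

/-- If `K (1 - T) = L` with `L`, `T` positive semidefinite and `T` divisible by `U(x) U(y)`,
`U(0) = 0`, then `K = ∑ T ^ r L` is positive semidefinite. -/
theorem IsPSD.of_mul_one_sub {K T L T' : Kernel} {U : PowerSeries ℝ}
    (hU : PowerSeries.constantCoeff U = 0) (hT' : T = inX U * inY U * T') (hT : IsPSD T)
    (hL : IsPSD L) (h : K * (1 - T) = L) : IsPSD K := by
  refine isPSD_of_agreeBelow fun N => ⟨∑ r ∈ Finset.range N, T ^ r * L,
    isPSD_sum _ _ fun r _ => (hT.pow r).mul hL, fun e h0 _ => ?_⟩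
  -- The remainder `T ^ N * K` is divisible by `U(x) ^ N U(y) ^ N`, hence invisible in the section
  -- of size `N`.
  have : K = ∑ r ∈ Finset.range N, T ^ r * L + T ^ N * K := by
    have hg := mul_neg_geom_sum T N
    rw [← Finset.sum_mul, ← h]
    linear_combination K * (-hg)
  have h2 : T ^ N * K = inX (U ^ N) * inY (U ^ N) * (T' ^ N * K) := by
    rw [hT', map_pow, map_pow]; ring
  rw [this, map_add, h2, coeff_inX_mul_inY_mul_eq_zero (X_pow_dvd_pow hU N) _ _ (Or.inl h0)
    (X_pow_dvd_pow hU N), add_zero]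


/-! ### Substitution into kernels -/

/-- Substitution of `(U(x), U(y))` for `(x, y)`. -/
noncomputable def substPair (U : PowerSeries ℝ) (K : Kernel) : Kernel :=
  subst ![inX U, inY U] K

section Subst

variable {U : PowerSeries ℝ}

theorem constantCoeff_inX (hU : PowerSeries.constantCoeff U = 0) :
    constantCoeff (inX U) = 0 := by
  rw [← coeff_zero_eq_constantCoeff_apply, coeff_inX]
  simpa using hU

theorem constantCoeff_inY (hU : PowerSeries.constantCoeff U = 0) :
    constantCoeff (inY U) = 0 := by
  rw [← coeff_zero_eq_constantCoeff_apply, coeff_inY]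
  simpa using hU

theorem hasSubst_pair (hU : PowerSeries.constantCoeff U = 0) :
    HasSubst (![inX U, inY U] : Fin 2 → Kernel) := by
  apply hasSubst_of_constantCoeff_zero
  intro i
  fin_cases i
  · exact constantCoeff_inX hU
  · exact constantCoeff_inY hU

theorem substPair_inX (hU : PowerSeries.constantCoeff U = 0) (f : PowerSeries ℝ) :
    substPair U (inX f) = inX (f.subst U) := by
  rw [substPair, inX_apply f, inX_apply (f.subst U),
    PowerSeries.subst_comp_subst_apply (PowerSeries.HasSubst.of_constantCoeff_zero' hU)
      (PowerSeries.HasSubst.X _),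
    PowerSeries.subst_def, PowerSeries.subst_def,
    subst_comp_subst_apply (PowerSeries.HasSubst.X _).const (hasSubst_pair hU)]
  congr 1
  funext _
  rw [subst_X (hasSubst_pair hU)]
  simp [inX_apply, PowerSeries.subst_def]

theorem substPair_inY (hU : PowerSeries.constantCoeff U = 0) (f : PowerSeries ℝ) :
    substPair U (inY f) = inY (f.subst U) := by
  rw [substPair, inY_apply f, inY_apply (f.subst U),
    PowerSeries.subst_comp_subst_apply (PowerSeries.HasSubst.of_constantCoeff_zero' hU)
      (PowerSeries.HasSubst.X _),
    PowerSeries.subst_def, PowerSeries.subst_def,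
    subst_comp_subst_apply (PowerSeries.HasSubst.X _).const (hasSubst_pair hU)]
  congr 1
  funext _
  rw [subst_X (hasSubst_pair hU)]
  simp [inY_apply, PowerSeries.subst_def]

/-- The monomial `x ^ i y ^ j` becomes `U(x) ^ i U(y) ^ j`, which has no terms of degree below `i`
in `x` or below `j` in `y`; hence entries below `N` come only from entries below `N`. -/
theorem AgreeBelow.substPair (hU : PowerSeries.constantCoeff U = 0) {N : ℕ} {K L : Kernel}
    (h : AgreeBelow N K L) : AgreeBelow N (substPair U K) (substPair U L) := by
  intro e h0 h1
  rw [Kernel.substPair, Kernel.substPair, coeff_subst (hasSubst_pair hU),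
    coeff_subst (hasSubst_pair hU)]
  refine finsum_congr fun d => ?_
  by_cases hd : d 0 < N ∧ d 1 < N
  · rw [h d hd.1 hd.2]
  · have : (d.prod fun s n => (![inX U, inY U] : Fin 2 → Kernel) s ^ n)
        = inX (U ^ d 0) * inY (U ^ d 1) := by
      rw [Finsupp.prod_fintype _ _ (by simp), Fin.prod_univ_two]
      simp
    rw [this, coeff_inX_mul_inY]
    have : ¬ (d 0 ≤ e 0 ∧ d 1 ≤ e 1) := by omega
    rw [not_and_or, not_le, not_le] at this
    rcases this with hlt | hlt
    · rw [PowerSeries.X_pow_dvd_iff.1 (X_pow_dvd_pow hU _) _ hlt]; simp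
    · rw [PowerSeries.X_pow_dvd_iff.1 (X_pow_dvd_pow hU (d 1)) _ hlt]; simp

theorem IsPSD.substPair (hU : PowerSeries.constantCoeff U = 0) {K : Kernel} (hK : IsPSD K) :
    IsPSD (substPair U K) := by
  intro N
  obtain ⟨ι, hι, f, hf⟩ := hK N
  refine ⟨ι, hι, fun l => (f l).subst U, fun e h0 h1 => ?_⟩
  rw [hf.substPair hU e h0 h1]
  congr 1
  have : Kernel.substPair U = substAlgHom (R := ℝ) (hasSubst_pair hU) := by
    rw [coe_substAlgHom]; rfl
  simp only [gram, ← substPair_inX hU, ← substPair_inY hU, this, map_sum, map_mul]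

end Subst

/-! ### Divided differences and Hankel kernels -/

/-- The divided difference `(f(x) - f(y)) / (x - y)`. -/
noncomputable def dividedDiff (f : PowerSeries ℝ) : Kernel :=
  fun e => PowerSeries.coeff (e 0 + e 1 + 1) f

theorem coeff_dividedDiff (f : PowerSeries ℝ) (e : Fin 2 →₀ ℕ) :
    coeff e (dividedDiff f) = PowerSeries.coeff (e 0 + e 1 + 1) f := rfl

theorem inX_X : inX PowerSeries.X = X 0 := by
  rw [inX_apply, PowerSeries.subst_X (PowerSeries.HasSubst.X _)]

theorem inY_X : inY PowerSeries.X = X 1 := by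
  rw [inY_apply, PowerSeries.subst_X (PowerSeries.HasSubst.X _)]

theorem coeff_X_mul_kernel (s : Fin 2) (K : Kernel) (e : Fin 2 →₀ ℕ) :
    coeff e (X s * K) = if 1 ≤ e s then coeff (e - Finsupp.single s 1) K else 0 := by
  rw [X, coeff_monomial_mul]
  simp

theorem sub_mul_dividedDiff (f : PowerSeries ℝ) :
    (inX PowerSeries.X - inY PowerSeries.X) * dividedDiff f = inX f - inY f := by
  ext e
  rw [inX_X, inY_X, sub_mul, map_sub, map_sub, coeff_X_mul_kernel, coeff_X_mul_kernel,
    coeff_dividedDiff, coeff_dividedDiff, coeff_inX, coeff_inY]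
  rcases Nat.eq_zero_or_pos (e 0) with h0 | h0 <;> rcases Nat.eq_zero_or_pos (e 1) with h1 | h1
  · simp [h0, h1]
  · have : e 1 - 1 + 1 = e 1 := by omega
    simp [h0, h1.ne', Nat.one_le_iff_ne_zero, this]
  · have : e 0 - 1 + 1 = e 0 := by omega
    simp [h1, h0.ne', Nat.one_le_iff_ne_zero, this]
  · have : e 0 - 1 + e 1 = e 0 + (e 1 - 1) := by omega
    simp [h1.ne', h0.ne', Nat.one_le_iff_ne_zero, this]

theorem inX_sub_inY_ne_zero :
    (inX PowerSeries.X - inY PowerSeries.X : Kernel) ≠ 0 := by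
  intro h
  have := congrArg (coeff (Finsupp.single 0 1)) h
  simp [coeff_inX, coeff_inY] at this

/-- Kernels form a domain, so identities between divided differences may be checked after
multiplication by `x - y`, where they become polynomial identities. -/
theorem eq_of_sub_mul_eq {K L : Kernel}
    (h : (inX PowerSeries.X - inY PowerSeries.X) * K
      = (inX PowerSeries.X - inY PowerSeries.X) * L) : K = L :=
  mul_left_cancel₀ inX_sub_inY_ne_zero h

theorem substPair_dividedDiff {U : PowerSeries ℝ} (hU : PowerSeries.constantCoeff U = 0)
    (f : PowerSeries ℝ) :
    (inX U - inY U) * substPair U (dividedDiff f) = inX (f.subst U) - inY (f.subst U) := by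
  have : Kernel.substPair U = substAlgHom (R := ℝ) (hasSubst_pair hU) := by
    rw [coe_substAlgHom]; rfl
  have h := congrArg (substPair U) (sub_mul_dividedDiff f)
  rw [this, map_mul, map_sub, map_sub, ← this] at h
  simpa only [substPair_inX hU, substPair_inY hU,
    PowerSeries.subst_X (PowerSeries.HasSubst.of_constantCoeff_zero' hU)] using h

/-- Deleting the first row and column of a Gram matrix amounts to dropping the constant coefficient
of every Gram vector. -/
theorem IsPSD.of_shift {K L : Kernel} (hL : IsPSD L)
    (h : ∀ e, coeff e K = coeff (e + Finsupp.single 0 1 + Finsupp.single 1 1) L) : IsPSD K := by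
  intro N
  obtain ⟨ι, hι, f, hf⟩ := hL (N + 1)
  refine ⟨ι, hι, fun l => PowerSeries.mk fun n => PowerSeries.coeff (n + 1) (f l),
    fun e h0 h1 => ?_⟩
  rw [h, hf _ (by simpa using h0) (by simpa using h1), coeff_gram, coeff_gram]
  simp

/-- Positive semidefiniteness of `1 + x y K` entails that of `K`. -/
theorem IsPSD.of_one_add {K : Kernel}
    (h : IsPSD (1 + inX PowerSeries.X * inY PowerSeries.X * K)) : IsPSD K := by
  refine h.of_shift fun e => ?_
  rw [map_add, inX_X, inY_X, mul_assoc, coeff_X_mul_kernel, coeff_X_mul_kernel]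
  have hne : e + Finsupp.single 0 1 + Finsupp.single 1 1 ≠ 0 := by
    intro h
    have := DFunLike.congr_fun h 0
    simp at this
  have he : e + Finsupp.single 0 1 + Finsupp.single 1 1 - Finsupp.single 0 1 - Finsupp.single 1 1
      = e := by
    ext i
    fin_cases i <;> simp
  rw [he, coeff_one, if_neg hne]
  simp

theorem dividedDiff_one_add_X_mul (B : PowerSeries ℝ) :
    dividedDiff (1 + PowerSeries.X * B) = dividedDiff (PowerSeries.X * B) := by
  ext e
  simp [coeff_dividedDiff, PowerSeries.coeff_one]

end Kernel

/-! ### Operations preserving Stieltjes series -/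

/-- `f = ∑ a_n X ^ n` where both Hankel matrices `(a_{i+j})` and `(a_{i+j+1})` are positive
semidefinite. -/
structure IsStieltjes (f : PowerSeries ℝ) : Prop where
  hankel : Kernel.IsPSD (Kernel.dividedDiff (PowerSeries.X * f))
  shifted : Kernel.IsPSD (Kernel.dividedDiff f)

namespace IsStieltjes

open Kernel PowerSeries

theorem smul {f : PowerSeries ℝ} (hf : IsStieltjes f) {c : ℝ} (hc : 0 ≤ c) :
    IsStieltjes (C c * f) := by
  have key : ∀ g : PowerSeries ℝ,
      dividedDiff (C c * g) = inX (C √c) * inY (C √c) * dividedDiff g := by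
    intro g
    have hX : inX (C c) = inX (C √c) * inY (C √c) := by
      ext e
      rw [coeff_inX_mul_inY, coeff_inX, coeff_C, coeff_C, coeff_C]
      split_ifs <;> simp_all
    have hY : inY (C c) = inX (C √c) * inY (C √c) := by
      ext e
      rw [coeff_inX_mul_inY, coeff_inY, coeff_C, coeff_C, coeff_C]
      split_ifs <;> simp_all
    apply eq_of_sub_mul_eq
    have h := sub_mul_dividedDiff g
    rw [sub_mul_dividedDiff, map_mul, map_mul, hX, hY]
    linear_combination (-inX (C √c) * inY (C √c)) * h
  constructor
  · rw [mul_left_comm, key]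
    exact (isPSD_rankOne _).mul hf.hankel
  · rw [key]
    exact (isPSD_rankOne _).mul hf.shifted

/-- If `B` is Stieltjes, so is `1 / (1 - X B)`. -/
theorem of_mul_one_sub {P B : PowerSeries ℝ} (hB : IsStieltjes B) (h : P * (1 - X * B) = 1) :
    IsStieltjes P := by
  have hx : inX P * (1 - inX X * inX B) = 1 := by simpa using congrArg inX h
  have hy : inY P * (1 - inY X * inY B) = 1 := by simpa using congrArg inY h
  have hD := sub_mul_dividedDiff B
  have hXB := sub_mul_dividedDiff (X * B)
  rw [map_mul, map_mul] at hXB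
  constructor
  -- Write `x P(x) - y P(y)` as `P(x) P(y) (x / P(y) - y / P(x))` and insert `1 / P = 1 - X B`.
  · have : dividedDiff (X * P) = inX P * inY P * (1 + inX X * inY X * dividedDiff B) := by
      apply eq_of_sub_mul_eq
      rw [sub_mul_dividedDiff, map_mul, map_mul]
      linear_combination (-inX P * inY P * inX X * inY X) * hD + (-inX X * inX P) * hy
        + (inY X * inY P) * hx
    rw [this]
    exact (isPSD_rankOne P).mul (isPSD_one.add ((isPSD_rankOne X).mul hB.shifted))
  · have : dividedDiff P = inX P * inY P * dividedDiff (X * B) := by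
      apply eq_of_sub_mul_eq
      rw [sub_mul_dividedDiff]
      linear_combination (-inX P * inY P) * hXB + (-inX P) * hy + inY P * hx
    rw [this]
    exact (isPSD_rankOne P).mul hB.hankel

/-- If `1 / (1 - X B)` is Stieltjes, so is `B`. -/
theorem of_inv {P B : PowerSeries ℝ} (hP : IsStieltjes P) (h : P * (1 - X * B) = 1) :
    IsStieltjes B := by
  have hx : inX P * (1 - inX X * inX B) = 1 := by simpa using congrArg inX h
  have hy : inY P * (1 - inY X * inY B) = 1 := by simpa using congrArg inY h
  have hD := sub_mul_dividedDiff P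
  have hXP := sub_mul_dividedDiff (X * P)
  have hB := sub_mul_dividedDiff B
  rw [map_mul, map_mul] at hXP
  constructor
  · have : dividedDiff (X * B) = inX (1 - X * B) * inY (1 - X * B) * dividedDiff P := by
      apply eq_of_sub_mul_eq
      rw [sub_mul_dividedDiff]
      simp only [map_sub, map_mul, map_one]
      linear_combination (-(1 - inX X * inX B) * (1 - inY X * inY B)) * hD
        - (1 - inY X * inY B) * hx + (1 - inX X * inX B) * hy
    rw [this]
    exact (isPSD_rankOne _).mul hP.shifted
  -- Solving the identity for `B` only controls `1 + x y D`, with `D` the divided difference of `B`;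
  -- the extra `1` sits in the first row and column, which are deleted.
  · apply IsPSD.of_one_add
    have : 1 + inX X * inY X * dividedDiff B
        = inX (1 - X * B) * inY (1 - X * B) * dividedDiff (X * P) := by
      apply eq_of_sub_mul_eq
      simp only [map_sub, map_mul, map_one]
      linear_combination (-(1 - inX X * inX B) * (1 - inY X * inY B)) * hXP
        + (inX X * inY X) * hB
        - inX X * (1 - inY X * inY B) * hx + inY X * (1 - inX X * inX B) * hy
    rw [this]
    exact (isPSD_rankOne _).mul hP.hankel

/-- The series with free cumulant series `1 + X B`, for a Stieltjes series `B`, is Stieltjes. -/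
theorem of_subst {G B : PowerSeries ℝ} (hB : IsStieltjes B)
    (h : G = (1 + X * B).subst (X * G)) : IsStieltjes G := by
  have hU : constantCoeff (X * G) = 0 := by simp
  have hs : HasSubst (X * G) := HasSubst.of_constantCoeff_zero' hU
  have h1 : (1 : PowerSeries ℝ).subst (X * G) = 1 := by
    rw [← coe_substAlgHom hs, map_one]
  have hG : G = 1 + X * G * B.subst (X * G) := by
    conv_lhs => rw [h]
    rw [subst_add hs, h1, subst_mul hs, subst_X hs]
  have hx : inX G = 1 + inX X * inX G * inX (B.subst (X * G)) := by
    simpa using congrArg inX hG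
  have hy : inY G = 1 + inY X * inY G * inY (B.subst (X * G)) := by
    simpa using congrArg inY hG
  have hDB := substPair_dividedDiff hU B
  have hDC := substPair_dividedDiff hU (1 + X * B)
  rw [← h] at hDC
  have hDG := sub_mul_dividedDiff (X * G)
  set T := inX (X * G) * inY (X * G) * substPair (X * G) (dividedDiff B) with hT
  -- With `U = X G` the equation for `G` reads `1 / x = 1 / U(x) + B(U(x))`. Subtracting its
  -- instances at `x` and `y` and dividing by `U(x) - U(y)` gives this identity.
  have hmul : dividedDiff (X * G) * (1 - T) = inX G * inY G := by
    apply eq_of_sub_mul_eq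
    simp only [hT, map_mul] at hDB hDG ⊢
    linear_combination (1 - inX X * inX G * (inY X * inY G)
      * substPair (X * G) (dividedDiff B)) * hDG - (inX X * inX G * (inY X * inY G)) * hDB
      - inX X * inX G * hy + inY X * inY G * hx
  have hankel : IsPSD (dividedDiff (X * G)) :=
    IsPSD.of_mul_one_sub hU hT ((isPSD_rankOne _).mul (hB.shifted.substPair hU))
      (isPSD_rankOne G) hmul
  refine ⟨hankel, ?_⟩
  -- Chain rule for divided differences, applied to `G = (1 + X B)(X G)`.
  have hfac : dividedDiff G
      = dividedDiff (X * G) * substPair (X * G) (dividedDiff (1 + X * B)) := by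
    apply eq_of_sub_mul_eq
    rw [sub_mul_dividedDiff, ← mul_assoc, hDG, hDC]
  rw [hfac, dividedDiff_one_add_X_mul]
  exact hankel.mul (hB.hankel.substPair hU)

/-- The coefficients of `B` are those of `1 + X B` moved by one place: its Hankel matrix is the
shifted one of `1 + X B`, and its shifted one is the Hankel matrix without first row and column. -/
theorem of_one_add_X_mul {B : PowerSeries ℝ} (h : IsStieltjes (1 + X * B)) : IsStieltjes B where
  hankel := by
    rw [← dividedDiff_one_add_X_mul]
    exact h.shifted
  shifted := by
    refine h.hankel.of_shift fun e => ?_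
    rw [coeff_dividedDiff, coeff_dividedDiff, coeff_succ_X_mul]
    have : (e + Finsupp.single 0 1 + Finsupp.single 1 1 : Fin 2 →₀ ℕ) 0
        + (e + Finsupp.single 0 1 + Finsupp.single 1 1 : Fin 2 →₀ ℕ) 1 = e 0 + e 1 + 1 + 1 := by
      simp
      omega
    rw [this, map_add, coeff_succ_X_mul, coeff_one, if_neg (by omega), zero_add]

end IsStieltjes

/-! ### Non-crossing partitions of intervals, cut at the successor of the least element -/

/-- `P` is a non-crossing partition of the interval `[a, b)` of natural numbers. -/
structure IsNCOn (a b : ℕ) (P : Finset (Finset ℕ)) : Prop where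
  nonempty : ∀ V ∈ P, V.Nonempty
  bounds : ∀ V ∈ P, ∀ x ∈ V, a ≤ x ∧ x < b
  cover : ∀ x, a ≤ x → x < b → ∃ V ∈ P, x ∈ V
  disjoint : ∀ V ∈ P, ∀ W ∈ P, ∀ x ∈ V, x ∈ W → V = W
  noncrossing : ∀ V ∈ P, ∀ W ∈ P, ∀ x y z w, x < y → y < z → z < w →
    x ∈ V → z ∈ V → y ∈ W → w ∈ W → V = W

open Classical in
/-- The non-crossing partitions of `[a, b)`. -/
noncomputable def ncOn (a b : ℕ) : Finset (Finset (Finset ℕ)) :=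
  (Finset.Ico a b).powerset.powerset.filter (IsNCOn a b)

theorem mem_ncOn {a b : ℕ} {P : Finset (Finset ℕ)} : P ∈ ncOn a b ↔ IsNCOn a b P := by
  classical
  simp only [ncOn, Finset.mem_filter, Finset.mem_powerset, and_iff_right_iff_imp]
  intro h V hV
  rw [Finset.mem_powerset]
  intro x hx
  exact Finset.mem_Ico.2 (h.bounds V hV x hx)

/-- `j` is the successor of `a` in its block. -/
def IsNext (a j : ℕ) (P : Finset (Finset ℕ)) : Prop :=
  ∃ V ∈ P, a ∈ V ∧ j ∈ V ∧ ∀ i, a < i → i < j → i ∉ V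

/-- Adjoin `a` to a block containing `j`. -/
def attach (a j : ℕ) (W : Finset ℕ) : Finset ℕ := if j ∈ W then insert a W else W

/-- Glue partitions of `[a + 1, j)` and `[j, b)` and put `a` into the block of `j`. -/
def glue (a j : ℕ) (L R : Finset (Finset ℕ)) : Finset (Finset ℕ) := L ∪ R.image (attach a j)

open Classical in
/-- The blocks contained in `(a, j)`. -/
noncomputable def innerPart (a j : ℕ) (P : Finset (Finset ℕ)) : Finset (Finset ℕ) :=
  P.filter fun V => ∀ x ∈ V, a < x ∧ x < j

open Classical in
/-- The blocks not contained in `(a, j)`, with `a` removed. -/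
noncomputable def outerPart (a j : ℕ) (P : Finset (Finset ℕ)) : Finset (Finset ℕ) :=
  (P.filter fun V => ¬ ∀ x ∈ V, a < x ∧ x < j).image fun V => V.erase a

theorem mem_glue {a j : ℕ} {L R : Finset (Finset ℕ)} {V : Finset ℕ} :
    V ∈ glue a j L R ↔ V ∈ L ∨ ∃ W ∈ R, attach a j W = V := by
  simp [glue]

theorem mem_attach {a j x : ℕ} {W : Finset ℕ} :
    x ∈ attach a j W ↔ x ∈ W ∨ (x = a ∧ j ∈ W) := by
  unfold attach
  split_ifs with h <;> simp [h, or_comm]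

theorem mem_innerPart {a j : ℕ} {P : Finset (Finset ℕ)} {V : Finset ℕ} :
    V ∈ innerPart a j P ↔ V ∈ P ∧ ∀ x ∈ V, a < x ∧ x < j := by
  simp [innerPart]

theorem mem_outerPart {a j : ℕ} {P : Finset (Finset ℕ)} {V : Finset ℕ} :
    V ∈ outerPart a j P ↔ ∃ W ∈ P, (¬ ∀ x ∈ W, a < x ∧ x < j) ∧ W.erase a = V := by
  simp only [outerPart, Finset.mem_image, Finset.mem_filter, and_assoc]

section Glue

variable {a j b : ℕ} {L R : Finset (Finset ℕ)}

theorem IsNCOn.not_mem_attach {x : ℕ} (hR : IsNCOn j b R) {W : Finset ℕ} (hW : W ∈ R)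
    (hax : a < x) (hxj : x < j) : x ∉ attach a j W := by
  rw [mem_attach]
  rintro (h | h)
  · have := hR.bounds W hW x h
    omega
  · omega

theorem IsNCOn.glue (haj : a < j) (hjb : j < b) (hL : IsNCOn (a + 1) j L) (hR : IsNCOn j b R) :
    IsNCOn a b (glue a j L R) where
  nonempty V hV := by
    rcases mem_glue.1 hV with hV | ⟨W, hW, rfl⟩
    · exact hL.nonempty V hV
    · obtain ⟨x, hx⟩ := hR.nonempty W hW
      exact ⟨x, mem_attach.2 (Or.inl hx)⟩
  bounds V hV x hx := by
    rcases mem_glue.1 hV with hV | ⟨W, hW, rfl⟩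
    · have := hL.bounds V hV x hx
      omega
    · rcases mem_attach.1 hx with hx | hx
      · have := hR.bounds W hW x hx
        omega
      · omega
  cover x hax hxb := by
    rcases hax.eq_or_lt with rfl | hax
    · obtain ⟨W, hW, hjW⟩ := hR.cover j le_rfl hjb
      exact ⟨_, mem_glue.2 (Or.inr ⟨W, hW, rfl⟩), mem_attach.2 (Or.inr ⟨rfl, hjW⟩)⟩
    · rcases lt_or_ge x j with hxj | hxj
      · obtain ⟨V, hV, hx⟩ := hL.cover x hax hxj
        exact ⟨V, mem_glue.2 (Or.inl hV), hx⟩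
      · obtain ⟨W, hW, hx⟩ := hR.cover x hxj hxb
        exact ⟨_, mem_glue.2 (Or.inr ⟨W, hW, rfl⟩), mem_attach.2 (Or.inl hx)⟩
  disjoint V hV V' hV' x hx hx' := by
    rcases mem_glue.1 hV with hV | ⟨W, hW, rfl⟩ <;> rcases mem_glue.1 hV' with hV' | ⟨W', hW', rfl⟩
    · exact hL.disjoint V hV V' hV' x hx hx'
    · have := hL.bounds V hV x hx
      exact absurd hx' (hR.not_mem_attach hW' (by omega) (by omega))
    · have := hL.bounds V' hV' x hx'
      exact absurd hx (hR.not_mem_attach hW (by omega) (by omega))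
    · rw [mem_attach] at hx hx'
      rcases hx with hx | hx <;> rcases hx' with hx' | hx'
      · rw [hR.disjoint W hW W' hW' x hx hx']
      · have := hR.bounds W hW x hx
        omega
      · have := hR.bounds W' hW' x hx'
        omega
      · rw [hR.disjoint W hW W' hW' j hx.2 hx'.2]
  noncrossing V hV V' hV' x y z w hxy hyz hzw hx hz hy hw := by
    rcases mem_glue.1 hV with hV | ⟨W, hW, rfl⟩ <;> rcases mem_glue.1 hV' with hV' | ⟨W', hW', rfl⟩
    · exact hL.noncrossing V hV V' hV' x y z w hxy hyz hzw hx hz hy hw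
    · have := hL.bounds V hV x hx
      have := hL.bounds V hV z hz
      exact absurd hy (hR.not_mem_attach hW' (by omega) (by omega))
    · have := hL.bounds V' hV' y hy
      have := hL.bounds V' hV' w hw
      exact absurd hz (hR.not_mem_attach hW (by omega) (by omega))
    · rw [mem_attach] at hx hy hz hw
      have hax : a ≤ x := by
        rcases hx with hx | hx
        · have := hR.bounds W hW x hx
          omega
        · omega
      replace hy := hy.resolve_right (by omega)
      replace hz := hz.resolve_right (by omega)
      replace hw := hw.resolve_right (by omega)
      rcases hx with hx | ⟨-, hx⟩
      · rw [hR.noncrossing W hW W' hW' x y z w hxy hyz hzw hx hz hy hw]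
      -- Here `x = a`, adjoined to the block of `j`. The point `j` takes its place in the crossing,
      -- unless `y = j`, when the two blocks meet.
      · rcases (hR.bounds W' hW' y hy).1.eq_or_lt with rfl | hjy
        · rw [hR.disjoint W hW W' hW' j hx hy]
        · rw [hR.noncrossing W hW W' hW' j y z w hjy hyz hzw hx hz hy hw]

theorem IsNCOn.isNext_glue (hjb : j < b) (hR : IsNCOn j b R) : IsNext a j (_root_.glue a j L R) := by
  obtain ⟨W, hW, hjW⟩ := hR.cover j le_rfl hjb
  exact ⟨_, mem_glue.2 (Or.inr ⟨W, hW, rfl⟩), mem_attach.2 (Or.inr ⟨rfl, hjW⟩),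
    mem_attach.2 (Or.inl hjW), fun i hai hij => hR.not_mem_attach hW hai hij⟩

theorem IsNCOn.innerPart_glue (hL : IsNCOn (a + 1) j L) (hR : IsNCOn j b R) :
    innerPart a j (_root_.glue a j L R) = L := by
  ext V
  rw [mem_innerPart, mem_glue]
  constructor
  · rintro ⟨hV | ⟨W, hW, rfl⟩, h⟩
    · exact hV
    · obtain ⟨x, hx⟩ := hR.nonempty W hW
      have := hR.bounds W hW x hx
      have := h x (mem_attach.2 (Or.inl hx))
      omega
  · intro hV
    refine ⟨Or.inl hV, fun x hx => ?_⟩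
    have := hL.bounds V hV x hx
    omega

theorem IsNCOn.erase_attach (haj : a < j) (hR : IsNCOn j b R) {W : Finset ℕ} (hW : W ∈ R) :
    (attach a j W).erase a = W := by
  have haW : a ∉ W := fun h => by
    have := hR.bounds W hW a h
    omega
  ext x
  rw [Finset.mem_erase, mem_attach]
  constructor
  · rintro ⟨hne, h | h⟩
    · exact h
    · exact absurd h.1 hne
  · intro h
    exact ⟨fun hxa => haW (hxa ▸ h), Or.inl h⟩

theorem IsNCOn.outerPart_glue (haj : a < j) (hL : IsNCOn (a + 1) j L) (hR : IsNCOn j b R) :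
    outerPart a j (_root_.glue a j L R) = R := by
  ext V
  rw [mem_outerPart]
  constructor
  · rintro ⟨W, hW, hn, rfl⟩
    rcases mem_glue.1 hW with hW | ⟨W', hW', rfl⟩
    · refine absurd (fun x hx => ?_) hn
      have := hL.bounds W hW x hx
      omega
    · rwa [hR.erase_attach haj hW']
  · intro hV
    refine ⟨attach a j V, mem_glue.2 (Or.inr ⟨V, hV, rfl⟩), fun h => ?_, hR.erase_attach haj hV⟩
    obtain ⟨x, hx⟩ := hR.nonempty V hV
    have := hR.bounds V hV x hx
    have := h x (mem_attach.2 (Or.inl hx))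
    omega

end Glue

section Split

variable {a j b : ℕ} {P : Finset (Finset ℕ)}

/-- A block with a point `x` in `(a, j)` and another point outside must have one beyond `j`, since
`a` and `j` belong to a different block; it would then cross that block. -/
theorem IsNCOn.not_mem_of_outer (hP : IsNCOn a b P) (hn : IsNext a j P) {V : Finset ℕ}
    (hV : V ∈ P) (hout : ¬ ∀ x ∈ V, a < x ∧ x < j) {x : ℕ} (hax : a < x) (hxj : x < j) :
    x ∉ V := by
  intro hx
  obtain ⟨V₀, hV₀, ha, hj, hgap⟩ := hn
  push Not at hout
  obtain ⟨y, hy, hyj⟩ := hout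
  have hne : V₀ ≠ V := fun h => hgap x hax hxj (h ▸ hx)
  have hay : a < y := by
    refine lt_of_le_of_ne (hP.bounds V hV y hy).1 fun h => hne ?_
    exact hP.disjoint V₀ hV₀ V hV a ha (h ▸ hy)
  have hjy : j < y := by
    refine lt_of_le_of_ne (hyj hay) fun h => hne ?_
    exact hP.disjoint V₀ hV₀ V hV j hj (h ▸ hy)
  exact hne (hP.noncrossing V₀ hV₀ V hV a x j y hax hxj hjy ha hj hx hy)

theorem IsNCOn.innerPart (hP : IsNCOn a b P) (hn : IsNext a j P) (hjb : j < b) :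
    IsNCOn (a + 1) j (innerPart a j P) where
  nonempty V hV := hP.nonempty V (mem_innerPart.1 hV).1
  bounds V hV x hx := (mem_innerPart.1 hV).2 x hx
  cover x hax hxj := by
    obtain ⟨V, hV, hx⟩ := hP.cover x (by omega) (by omega)
    refine ⟨V, mem_innerPart.2 ⟨hV, ?_⟩, hx⟩
    by_contra hout
    exact hP.not_mem_of_outer hn hV hout hax hxj hx
  disjoint V hV W hW := hP.disjoint V (mem_innerPart.1 hV).1 W (mem_innerPart.1 hW).1
  noncrossing V hV W hW := hP.noncrossing V (mem_innerPart.1 hV).1 W (mem_innerPart.1 hW).1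

theorem IsNCOn.outerPart (hP : IsNCOn a b P) (hn : IsNext a j P) (haj : a < j) :
    IsNCOn j b (outerPart a j P) where
  nonempty V hV := by
    obtain ⟨W, hW, hout, rfl⟩ := mem_outerPart.1 hV
    push Not at hout
    obtain ⟨y, hy, hyj⟩ := hout
    obtain ⟨V₀, hV₀, ha, hj, hgap⟩ := hn
    by_cases hya : y = a
    · have : V₀ = W := hP.disjoint V₀ hV₀ W hW a ha (hya ▸ hy)
      exact ⟨j, Finset.mem_erase.2 ⟨by omega, this ▸ hj⟩⟩
    · exact ⟨y, Finset.mem_erase.2 ⟨hya, hy⟩⟩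
  bounds V hV x hx := by
    obtain ⟨W, hW, hout, rfl⟩ := mem_outerPart.1 hV
    obtain ⟨hxa, hx⟩ := Finset.mem_erase.1 hx
    have := hP.bounds W hW x hx
    refine ⟨?_, this.2⟩
    by_contra hlt
    exact hP.not_mem_of_outer hn hW hout (by omega) (by omega) hx
  cover x hjx hxb := by
    obtain ⟨V, hV, hx⟩ := hP.cover x (by omega) hxb
    refine ⟨V.erase a, mem_outerPart.2 ⟨V, hV, fun h => ?_, rfl⟩,
      Finset.mem_erase.2 ⟨by omega, hx⟩⟩
    have := h x hx
    omega
  disjoint V hV V' hV' x hx hx' := by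
    obtain ⟨W, hW, -, rfl⟩ := mem_outerPart.1 hV
    obtain ⟨W', hW', -, rfl⟩ := mem_outerPart.1 hV'
    rw [hP.disjoint W hW W' hW' x (Finset.mem_of_mem_erase hx) (Finset.mem_of_mem_erase hx')]
  noncrossing V hV V' hV' x y z w hxy hyz hzw hx hz hy hw := by
    obtain ⟨W, hW, -, rfl⟩ := mem_outerPart.1 hV
    obtain ⟨W', hW', -, rfl⟩ := mem_outerPart.1 hV'
    rw [hP.noncrossing W hW W' hW' x y z w hxy hyz hzw (Finset.mem_of_mem_erase hx)
      (Finset.mem_of_mem_erase hz) (Finset.mem_of_mem_erase hy) (Finset.mem_of_mem_erase hw)]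

theorem IsNCOn.attach_erase (hP : IsNCOn a b P) (hn : IsNext a j P) (haj : a < j)
    {V : Finset ℕ} (hV : V ∈ P) : attach a j (V.erase a) = V := by
  obtain ⟨V₀, hV₀, ha, hj, -⟩ := hn
  ext x
  rw [mem_attach, Finset.mem_erase, Finset.mem_erase]
  constructor
  · rintro (h | ⟨rfl, -, h⟩)
    · exact h.2
    · rwa [← hP.disjoint V₀ hV₀ V hV j hj h]
  · intro hx
    by_cases hxa : x = a
    · subst hxa
      exact Or.inr ⟨rfl, by omega, hP.disjoint V₀ hV₀ V hV x ha hx ▸ hj⟩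
    · exact Or.inl ⟨hxa, hx⟩

theorem IsNCOn.glue_parts (hP : IsNCOn a b P) (hn : IsNext a j P) (haj : a < j) :
    _root_.glue a j (_root_.innerPart a j P) (_root_.outerPart a j P) = P := by
  ext V
  rw [mem_glue, mem_innerPart]
  constructor
  · rintro (h | ⟨W, hW, rfl⟩)
    · exact h.1
    · obtain ⟨W', hW', -, rfl⟩ := mem_outerPart.1 hW
      rwa [hP.attach_erase hn haj hW']
  · intro hV
    by_cases h : ∀ x ∈ V, a < x ∧ x < j
    · exact Or.inl ⟨hV, h⟩
    · exact Or.inr ⟨V.erase a, mem_outerPart.2 ⟨V, hV, h, rfl⟩, hP.attach_erase hn haj hV⟩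

end Split

/-! ### Recursion for weighted sums over non-crossing partitions -/

section Sum

variable {R : Type*} [CommRing R]

/-- The sum over the non-crossing partitions of `[a, b)` in which the block of `a` is weighted by
`φ` and the other blocks are weighted by `κ`. -/
noncomputable def ncSum (φ κ : ℕ → R) (a b : ℕ) : R :=
  ∑ P ∈ ncOn a b, ∏ V ∈ P, if a ∈ V then φ V.card else κ V.card

theorem ncSum_self (κ : ℕ → R) (a b : ℕ) :
    ncSum κ κ a b = ∑ P ∈ ncOn a b, ∏ V ∈ P, κ V.card := by
  simp [ncSum]

theorem ncOn_self (a : ℕ) : ncOn a a = {∅} := by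
  ext P
  rw [mem_ncOn, Finset.mem_singleton]
  constructor
  · intro h
    rw [Finset.eq_empty_iff_forall_notMem]
    intro V hV
    obtain ⟨x, hx⟩ := h.nonempty V hV
    have := h.bounds V hV x hx
    omega
  · rintro rfl
    constructor <;> intros <;> first | omega | simp_all

theorem ncSum_empty (φ κ : ℕ → R) (a : ℕ) : ncSum φ κ a a = 1 := by
  simp [ncSum, ncOn_self]

-- Removing `a` leaves its block as the block of `j`, the least element of `[j, b)`, with one point
-- fewer; hence the shifted weight. This is why the first block carries a weight `φ` of its own.
open Classical in
theorem sum_isNext (φ κ : ℕ → R) {a j b : ℕ} (haj : a < j) (hjb : j < b) :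
    ∑ P ∈ (ncOn a b).filter (IsNext a j), (∏ V ∈ P, if a ∈ V then φ V.card else κ V.card)
      = ncSum κ κ (a + 1) j * ncSum (fun n => φ (n + 1)) κ j b := by
  rw [ncSum_self, ncSum, Finset.sum_mul_sum, ← Finset.sum_product']
  symm
  refine Finset.sum_bij' (fun p _ => glue a j p.1 p.2)
    (fun P _ => (innerPart a j P, outerPart a j P)) ?_ ?_ ?_ ?_ ?_
  · rintro ⟨L, R⟩ h
    rw [Finset.mem_product, mem_ncOn, mem_ncOn] at h
    rw [Finset.mem_filter, mem_ncOn]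
    exact ⟨h.1.glue haj hjb h.2, h.2.isNext_glue hjb⟩
  · intro P h
    rw [Finset.mem_filter, mem_ncOn] at h
    rw [Finset.mem_product, mem_ncOn, mem_ncOn]
    exact ⟨h.1.innerPart h.2 hjb, h.1.outerPart h.2 haj⟩
  · rintro ⟨L, R⟩ h
    rw [Finset.mem_product, mem_ncOn, mem_ncOn] at h
    exact Prod.ext (h.1.innerPart_glue h.2) (h.1.outerPart_glue haj h.2)
  · intro P h
    rw [Finset.mem_filter, mem_ncOn] at h
    exact h.1.glue_parts h.2 haj
  · rintro ⟨L, R⟩ h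
    rw [Finset.mem_product, mem_ncOn, mem_ncOn] at h
    obtain ⟨hL, hR⟩ := h
    simp only at hL hR ⊢
    rw [glue, Finset.prod_union, Finset.prod_image]
    · congr 1
      · refine Finset.prod_congr rfl fun V hV => (if_neg fun ha => ?_).symm
        have := hL.bounds V hV a ha
        omega
      · refine Finset.prod_congr rfl fun W hW => ?_
        have haW : a ∉ W := fun h => by
          have := hR.bounds W hW a h
          omega
        by_cases hj : j ∈ W
        · rw [if_pos hj, if_pos (mem_attach.2 (Or.inr ⟨rfl, hj⟩)), attach, if_pos hj,
            Finset.card_insert_of_notMem haW]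
        · rw [if_neg hj, attach, if_neg hj, if_neg haW]
    · intro W hW W' hW' h
      rw [← hR.erase_attach haj hW, h, hR.erase_attach haj hW']
    · rw [Finset.disjoint_left]
      intro V hV hV'
      obtain ⟨W, hW, rfl⟩ := Finset.mem_image.1 hV'
      obtain ⟨x, hx⟩ := hL.nonempty _ hV
      have := hL.bounds _ hV x hx
      exact hR.not_mem_attach hW (by omega) (by omega) hx

theorem IsNCOn.insert_singleton {a b : ℕ} (hab : a < b) {Q : Finset (Finset ℕ)}
    (hQ : IsNCOn (a + 1) b Q) : IsNCOn a b (insert {a} Q) where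
  nonempty V hV := by
    rcases Finset.mem_insert.1 hV with rfl | hV
    · exact Finset.singleton_nonempty a
    · exact hQ.nonempty V hV
  bounds V hV x hx := by
    rcases Finset.mem_insert.1 hV with rfl | hV
    · rw [Finset.mem_singleton] at hx
      omega
    · have := hQ.bounds V hV x hx
      omega
  cover x hax hxb := by
    rcases hax.eq_or_lt with rfl | hax
    · exact ⟨_, Finset.mem_insert_self _ _, Finset.mem_singleton_self _⟩
    · obtain ⟨V, hV, hx⟩ := hQ.cover x hax hxb
      exact ⟨V, Finset.mem_insert_of_mem hV, hx⟩
  disjoint V hV W hW x hx hx' := by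
    rcases Finset.mem_insert.1 hV with rfl | hV <;> rcases Finset.mem_insert.1 hW with rfl | hW
    · rfl
    · have := hQ.bounds W hW x hx'
      rw [Finset.mem_singleton] at hx
      omega
    · have := hQ.bounds V hV x hx
      rw [Finset.mem_singleton] at hx'
      omega
    · exact hQ.disjoint V hV W hW x hx hx'
  noncrossing V hV W hW x y z w hxy hyz hzw hx hz hy hw := by
    rcases Finset.mem_insert.1 hV with rfl | hV <;> rcases Finset.mem_insert.1 hW with rfl | hW
    · rfl
    · rw [Finset.mem_singleton] at hx hz
      omega
    · rw [Finset.mem_singleton] at hy hw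
      omega
    · exact hQ.noncrossing V hV W hW x y z w hxy hyz hzw hx hz hy hw

theorem IsNCOn.erase_singleton {a b : ℕ} {P : Finset (Finset ℕ)}
    (hP : IsNCOn a b P) (ha : {a} ∈ P) : IsNCOn (a + 1) b (P.erase {a}) where
  nonempty V hV := hP.nonempty V (Finset.mem_of_mem_erase hV)
  bounds V hV x hx := by
    obtain ⟨hne, hV⟩ := Finset.mem_erase.1 hV
    have := hP.bounds V hV x hx
    refine ⟨?_, this.2⟩
    by_contra hlt
    have hxa : x = a := by omega
    exact hne (hP.disjoint V hV {a} ha x hx (by simp [hxa]))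
  cover x hax hxb := by
    obtain ⟨V, hV, hx⟩ := hP.cover x (by omega) hxb
    refine ⟨V, Finset.mem_erase.2 ⟨?_, hV⟩, hx⟩
    rintro rfl
    rw [Finset.mem_singleton] at hx
    omega
  disjoint V hV W hW :=
    hP.disjoint V (Finset.mem_of_mem_erase hV) W (Finset.mem_of_mem_erase hW)
  noncrossing V hV W hW :=
    hP.noncrossing V (Finset.mem_of_mem_erase hV) W (Finset.mem_of_mem_erase hW)

theorem sum_singleton_mem (φ κ : ℕ → R) {a b : ℕ} (hab : a < b) :
    ∑ P ∈ (ncOn a b).filter ({a} ∈ ·), (∏ V ∈ P, if a ∈ V then φ V.card else κ V.card)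
      = φ 1 * ncSum κ κ (a + 1) b := by
  rw [ncSum_self, Finset.mul_sum]
  symm
  have hnot : ∀ Q, IsNCOn (a + 1) b Q → {a} ∉ Q := fun Q hQ h => by
    have := hQ.bounds {a} h a (by simp)
    omega
  refine Finset.sum_bij' (fun Q _ => insert {a} Q) (fun P _ => P.erase {a}) ?_ ?_ ?_ ?_ ?_
  · intro Q hQ
    rw [mem_ncOn] at hQ
    rw [Finset.mem_filter, mem_ncOn]
    exact ⟨hQ.insert_singleton hab, Finset.mem_insert_self _ _⟩
  · intro P hP
    rw [Finset.mem_filter, mem_ncOn] at hP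
    exact mem_ncOn.2 (hP.1.erase_singleton hP.2)
  · intro Q hQ
    exact Finset.erase_insert (hnot Q (mem_ncOn.1 hQ))
  · intro P hP
    exact Finset.insert_erase (Finset.mem_filter.1 hP).2
  · intro Q hQ
    rw [mem_ncOn] at hQ
    rw [Finset.prod_insert (hnot Q hQ)]
    simp only [Finset.mem_singleton, if_true, Finset.card_singleton]
    congr 1
    refine Finset.prod_congr rfl fun V hV => (if_neg fun ha => ?_).symm
    have := hQ.bounds V hV a ha
    omega

/-- The partitions are sorted by the successor of `a` in its block; the first term collects those in
which `{a}` is a block. -/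
theorem ncSum_eq (φ κ : ℕ → R) {a b : ℕ} (hab : a < b) :
    ncSum φ κ a b = φ 1 * ncSum κ κ (a + 1) b
      + ∑ j ∈ Finset.Ioo a b, ncSum κ κ (a + 1) j * ncSum (fun n => φ (n + 1)) κ j b := by
  classical
  rw [← sum_singleton_mem φ κ hab]
  have : ∀ j ∈ Finset.Ioo a b, ncSum κ κ (a + 1) j * ncSum (fun n => φ (n + 1)) κ j b
      = ∑ P ∈ (ncOn a b).filter (IsNext a j),
          (∏ V ∈ P, if a ∈ V then φ V.card else κ V.card) := fun j hj => by
    rw [Finset.mem_Ioo] at hj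
    rw [sum_isNext φ κ hj.1 hj.2]
  rw [Finset.sum_congr rfl this]
  simp only [Finset.sum_filter]
  rw [Finset.sum_comm, ← Finset.sum_add_distrib, ncSum]
  refine Finset.sum_congr rfl fun P hP => ?_
  rw [mem_ncOn] at hP
  by_cases ha : {a} ∈ P
  · rw [if_pos ha, Finset.sum_eq_zero, add_zero]
    intro j hj
    rw [Finset.mem_Ioo] at hj
    refine if_neg ?_
    rintro ⟨V, hV, haV, hjV, -⟩
    rw [hP.disjoint V hV {a} ha a haV (by simp), Finset.mem_singleton] at hjV
    omega
  · obtain ⟨V, hV, haV⟩ := hP.cover a le_rfl hab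
    have hex : ∃ x, a < x ∧ x ∈ V := by
      by_contra hne
      push Not at hne
      apply ha
      convert hV
      symm
      rw [Finset.eq_singleton_iff_unique_mem]
      refine ⟨haV, fun x hx => ?_⟩
      by_contra hxa
      exact hne x (lt_of_le_of_ne (hP.bounds V hV x hx).1 (Ne.symm hxa)) hx
    -- The least element of `V` beyond `a` is the only index `j` contributing to the sum.
    have hspec := Nat.find_spec hex
    rw [if_neg ha, zero_add, Finset.sum_eq_single (Nat.find hex), if_pos]
    · exact ⟨V, hV, haV, hspec.2, fun i hai hi hiV => Nat.find_min hex hi ⟨hai, hiV⟩⟩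
    · intro j hj hne
      rw [Finset.mem_Ioo] at hj
      refine if_neg ?_
      rintro ⟨W, hW, haW, hjW, hgap⟩
      obtain rfl := hP.disjoint V hV W hW a haV haW
      rcases lt_or_gt_of_ne hne with hlt | hlt
      · exact Nat.find_min hex hlt ⟨hj.1, hjW⟩
      · exact hgap _ hspec.1 hlt hspec.2
    · intro h
      rw [Finset.mem_Ioo] at h
      exact absurd ⟨hspec.1, (hP.bounds V hV _ hspec.2).2⟩ h

theorem ncSum_eq_range (φ κ : ℕ → R) (a n : ℕ) :
    ncSum φ κ a (a + (n + 1)) = φ 1 * ncSum κ κ (a + 1) (a + 1 + n)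
      + ∑ i ∈ Finset.range n, ncSum κ κ (a + 1) (a + 1 + i)
          * ncSum (fun n => φ (n + 1)) κ (a + 1 + i) (a + 1 + i + (n - i)) := by
  rw [ncSum_eq φ κ (by omega), show a + (n + 1) = a + 1 + n by omega]
  congr 1
  symm
  refine Finset.sum_bij' (fun i _ => a + 1 + i) (fun j _ => j - (a + 1)) ?_ ?_ ?_ ?_ ?_
  all_goals
    intro i hi
    simp only [Finset.mem_range, Finset.mem_Ioo] at hi ⊢
  · omega
  · omega
  · omega
  · omega
  · rw [show a + 1 + i + (n - i) = a + 1 + n by omega]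

/-- Translation invariance follows from the recursion, without transporting partitions. -/
theorem ncSum_shift (κ : ℕ → R) (n : ℕ) :
    ∀ (φ : ℕ → R) (a : ℕ), ncSum φ κ a (a + n) = ncSum φ κ 0 n := by
  induction n using Nat.strong_induction_on with
  | _ n ih =>
    intro φ a
    rcases n with _ | n
    · rw [add_zero, ncSum_empty, ncSum_empty]
    · have h0 := ncSum_eq_range φ κ 0 n
      rw [zero_add] at h0
      rw [h0, ncSum_eq_range, ih n (by omega), ih n (by omega)]
      congr 1
      refine Finset.sum_congr rfl fun i hi => ?_
      rw [Finset.mem_range] at hi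
      rw [ih i (by omega), ih i (by omega), ih (n - i) (by omega), ih (n - i) (by omega)]

theorem ncSum_succ (φ κ : ℕ → R) (n : ℕ) :
    ncSum φ κ 0 (n + 1) = φ 1 * ncSum κ κ 0 n
      + ∑ i ∈ Finset.range n, ncSum κ κ 0 i * ncSum (fun n => φ (n + 1)) κ 0 (n - i) := by
  have h0 := ncSum_eq_range φ κ 0 n
  rw [zero_add] at h0
  rw [h0, ncSum_shift]
  congr 1
  refine Finset.sum_congr rfl fun i _ => ?_
  rw [ncSum_shift, ncSum_shift]

end Sum

/-! ### Transfer to partitions of `Fin n` -/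

section FiniteOrdinals

theorem IsNonCrossing.isNCOn {n : ℕ} {π : SetPartition n} (h : IsNonCrossing π) :
    IsNCOn 0 n (π.parts.map (Finset.mapEmbedding Fin.valEmbedding).toEmbedding) where
  nonempty V hV := by
    obtain ⟨V', hV', rfl⟩ := Finset.mem_map.1 hV
    simpa using π.nonempty_of_mem_parts hV'
  bounds V hV x hx := by
    obtain ⟨V, hV, rfl⟩ := Finset.mem_map.1 hV
    obtain ⟨i, -, rfl⟩ := Finset.mem_map.1 hx
    exact ⟨Nat.zero_le _, i.2⟩
  cover x _ hx := by
    obtain ⟨V, hV, hxV⟩ := π.exists_mem (Finset.mem_univ (⟨x, hx⟩ : Fin n))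
    exact ⟨_, Finset.mem_map_of_mem _ hV, Finset.mem_map_of_mem Fin.valEmbedding hxV⟩
  disjoint V hV W hW x hx hx' := by
    obtain ⟨V', hV', rfl⟩ := Finset.mem_map.1 hV
    obtain ⟨W', hW', rfl⟩ := Finset.mem_map.1 hW
    obtain ⟨i, hi, rfl⟩ := Finset.mem_map.1 hx
    obtain ⟨j, hj, hij⟩ := Finset.mem_map.1 hx'
    rw [Fin.valEmbedding.injective hij] at hj
    rw [π.eq_of_mem_parts hV' hW' hi hj]
  noncrossing V hV W hW x y z w hxy hyz hzw hx hz hy hw := by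
    obtain ⟨V', hV', rfl⟩ := Finset.mem_map.1 hV
    obtain ⟨W', hW', rfl⟩ := Finset.mem_map.1 hW
    obtain ⟨x', hx', rfl⟩ := Finset.mem_map.1 hx
    obtain ⟨y', hy', rfl⟩ := Finset.mem_map.1 hy
    obtain ⟨z', hz', rfl⟩ := Finset.mem_map.1 hz
    obtain ⟨w', hw', rfl⟩ := Finset.mem_map.1 hw
    rw [h V' hV' W' hW' x' y' z' w' hxy hyz hzw hx' hz' hy' hw']

theorem IsNCOn.exists_setPartition {n : ℕ} {P : Finset (Finset ℕ)} (h : IsNCOn 0 n P) :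
    ∃ π : SetPartition n, IsNonCrossing π ∧
      π.parts.map (Finset.mapEmbedding Fin.valEmbedding).toEmbedding = P := by
  classical
  let parts : Finset (Finset (Fin n)) :=
    Finset.univ.filter fun V => V.map Fin.valEmbedding ∈ P
  have hmem : ∀ V, V ∈ parts ↔ V.map Fin.valEmbedding ∈ P := fun V => by simp [parts]
  have hval : ∀ V ∈ P, ∃ V' : Finset (Fin n), V'.map Fin.valEmbedding = V := fun V hV =>
    ⟨V.attachFin fun m hm => (h.bounds V hV m hm).2, Finset.map_valEmbedding_attachFin _⟩
  have hmv : ∀ {x : Fin n} {V : Finset (Fin n)}, x ∈ V → (x : ℕ) ∈ V.map Fin.valEmbedding :=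
    fun hx => Finset.mem_map_of_mem Fin.valEmbedding hx
  have hinj : Function.Injective (Finset.map (Fin.valEmbedding (n := n))) :=
    Finset.map_injective _
  refine ⟨Finpartition.ofExistsUnique parts (fun _ _ => Finset.subset_univ _) ?_ ?_, ?_, ?_⟩
  · intro x _
    obtain ⟨V, hV, hx⟩ := h.cover x (Nat.zero_le _) x.2
    obtain ⟨V, rfl⟩ := hval V hV
    have hxV : x ∈ V := by simpa [Fin.val_inj] using hx
    refine ⟨V, ⟨(hmem V).2 hV, hxV⟩, fun W hW => ?_⟩
    exact hinj (h.disjoint _ ((hmem W).1 hW.1) _ hV x (hmv hW.2) hx)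
  · intro h0
    obtain ⟨x, hx⟩ := h.nonempty _ ((hmem _).1 h0)
    simp at hx
  · intro V hV W hW a b c d hab hbc hcd ha hc hb hd
    exact hinj (h.noncrossing _ ((hmem V).1 hV) _ ((hmem W).1 hW) a b c d hab hbc hcd
      (hmv ha) (hmv hc) (hmv hb) (hmv hd))
  · ext V
    constructor
    · intro hV
      obtain ⟨V', hV', rfl⟩ := Finset.mem_map.1 hV
      exact (hmem V').1 hV'
    · intro hV
      obtain ⟨V, rfl⟩ := hval V hV
      exact Finset.mem_map_of_mem _ ((hmem V).2 hV)

theorem sum_NC_eq_ncSum {R : Type*} [CommRing R] (κ : ℕ → R) (n : ℕ) :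
    ∑ π ∈ NC n, ∏ V ∈ π.parts, κ V.card = ncSum κ κ 0 n := by
  rw [ncSum_self]
  have hNC : ∀ π : SetPartition n, π ∈ NC n ↔ IsNonCrossing π := fun π => by simp [NC]
  refine Finset.sum_bij
    (fun π _ => π.parts.map (Finset.mapEmbedding Fin.valEmbedding).toEmbedding) ?_ ?_ ?_ ?_
  · intro π hπ
    exact mem_ncOn.2 ((hNC π).1 hπ).isNCOn
  · intro π _ π' _ h
    exact Finpartition.ext (Finset.map_injective _ h)
  · intro P hP
    obtain ⟨π, hπ, h⟩ := (mem_ncOn.1 hP).exists_setPartition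
    exact ⟨π, (hNC π).2 hπ, h⟩
  · intro π _
    simp [Finset.prod_map]

end FiniteOrdinals

/-! ### The functional equation between moments and cumulants -/

section FunctionalEquation

open PowerSeries

variable {R : Type*} [CommRing R]

/-- The series `∑_{n ≥ 1} φ n X ^ n`. -/
noncomputable def tailSeries (φ : ℕ → R) : R⟦X⟧ := mk fun n => if n = 0 then 0 else φ n

/-- The series `1 + ∑_{n ≥ 1} κ n X ^ n`. -/
noncomputable def cumulantSeries (κ : ℕ → R) : R⟦X⟧ := 1 + tailSeries κ

theorem tailSeries_eq (φ : ℕ → R) :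
    tailSeries φ = X * (C (φ 1) + tailSeries fun n => φ (n + 1)) := by
  ext n
  rcases n with _ | n
  · simp [tailSeries]
  · rw [coeff_succ_X_mul, map_add, coeff_C]
    rcases n with _ | n <;> simp [tailSeries]

theorem constantCoeff_X_mul (M : R⟦X⟧) : constantCoeff (X * M) = 0 := by simp

theorem hasSubst_X_mul (M : R⟦X⟧) : HasSubst (X * M) :=
  HasSubst.of_constantCoeff_zero' (constantCoeff_X_mul M)

theorem one_subst {a : R⟦X⟧} (ha : HasSubst a) : (1 : R⟦X⟧).subst a = 1 := by
  rw [← coe_substAlgHom ha, map_one]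

theorem C_subst (a : R⟦X⟧) (r : R) : (C r : R⟦X⟧).subst a = C r := subst_C r

theorem eq_of_forall_X_pow_dvd_sub {f g : R⟦X⟧} (h : ∀ n, X ^ n ∣ f - g) : f = g := by
  rw [← sub_eq_zero]
  ext n
  simpa using X_pow_dvd_iff.1 (h (n + 1)) n (by omega)

theorem tailSeries_ncSum_eq (φ κ : ℕ → R) :
    tailSeries (ncSum φ κ 0) = X * mk (ncSum κ κ 0) *
      (C (φ 1) + tailSeries (ncSum (fun n => φ (n + 1)) κ 0)) := by
  ext n
  rcases n with _ | n
  · simp [tailSeries]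
  -- The index `i = n` of the Cauchy product drops out because a tail series has no constant term.
  · rw [mul_assoc, coeff_succ_X_mul, mul_add, map_add, mul_comm _ (C _), coeff_C_mul, coeff_mk,
      coeff_mul, Finset.Nat.sum_antidiagonal_eq_sum_range_succ_mk, Finset.sum_range_succ]
    simp only [tailSeries, coeff_mk, Nat.succ_ne_zero, if_false, ncSum_succ, Nat.sub_self, if_true,
      mul_zero, add_zero]
    congr 1
    refine Finset.sum_congr rfl fun i hi => ?_
    rw [Finset.mem_range] at hi
    rw [if_neg (by omega)]

/-- Both sides satisfy the recursion `F φ = X M (φ 1 + F (shifted φ))`, so each unfolding adds a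
factor `X` to their difference. The statement is needed for all `φ` at once because the recursion
shifts `φ`. -/
theorem tailSeries_ncSum_eq_subst (φ κ : ℕ → R) :
    tailSeries (ncSum φ κ 0) = (tailSeries φ).subst (X * mk (ncSum κ κ 0)) := by
  set M := mk (ncSum κ κ 0) with hM
  have hs := hasSubst_X_mul M
  apply eq_of_forall_X_pow_dvd_sub
  intro n
  induction n generalizing φ with
  | zero => simp
  | succ n ih =>
    have : tailSeries (ncSum φ κ 0) - (tailSeries φ).subst (X * M)
        = X * (M * (tailSeries (ncSum (fun n => φ (n + 1)) κ 0)
          - (tailSeries fun n => φ (n + 1)).subst (X * M))) := by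
      rw [tailSeries_ncSum_eq, tailSeries_eq φ, subst_mul hs, subst_X hs, subst_add hs, C_subst]
      ring
    rw [this, pow_succ']
    exact mul_dvd_mul_left _ (dvd_mul_of_dvd_right (ih _) _)

/-- The functional equation `M = C(X M)` between the generating function of the non-crossing sums
and that of the weights. -/
theorem mk_ncSum_eq_subst (κ : ℕ → R) :
    mk (ncSum κ κ 0) = (cumulantSeries κ).subst (X * mk (ncSum κ κ 0)) := by
  have hs := hasSubst_X_mul (mk (ncSum κ κ 0))
  rw [cumulantSeries, subst_add hs, one_subst hs, ← tailSeries_ncSum_eq_subst]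
  ext n
  rcases n with _ | n
  · simp [tailSeries, ncSum_empty]
  · simp [tailSeries, coeff_one]

theorem cumulantSeries_coeff {f : R⟦X⟧} (hf : constantCoeff f = 1) :
    cumulantSeries (fun n => coeff n f) = f := by
  ext n
  rcases n with _ | n
  · simpa [cumulantSeries, tailSeries] using hf.symm
  · simp [cumulantSeries, tailSeries, coeff_one]

/-- The solution is the moment series whose cumulants are the coefficients of `f`. -/
theorem exists_eq_subst {f : R⟦X⟧} (hf : constantCoeff f = 1) :
    ∃ G : R⟦X⟧, G = f.subst (X * G) ∧ constantCoeff G = 1 := by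
  refine ⟨mk (ncSum (fun n => coeff n f) (fun n => coeff n f) 0), ?_, ?_⟩
  · have h := mk_ncSum_eq_subst fun n => coeff n f
    rwa [cumulantSeries_coeff hf] at h
  · rw [← coeff_zero_eq_constantCoeff_apply, coeff_mk, ncSum_empty]

/-- As `M(0) = 1`, the series `X M` has a compositional inverse. Hence the functional equation
determines the cumulants. -/
theorem subst_X_mul_injective {M : R⟦X⟧} (hM : constantCoeff M = 1) {f g : R⟦X⟧}
    (h : f.subst (X * M) = g.subst (X * M)) : f = g := by
  have hu : IsUnit (coeff 1 (X * M)) := by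
    rw [show (1 : ℕ) = 0 + 1 from rfl, coeff_succ_X_mul, coeff_zero_eq_constantCoeff_apply, hM]
    exact isUnit_one
  have hs := hasSubst_X_mul M
  have hi := HasSubst.substInvOfIsUnit (P := X * M) (hP' := hu)
  have key := subst_substInvOfIsUnit_right (P := X * M) (constantCoeff_X_mul M) (hP' := hu)
  have h2 := congrArg (subst (substInvOfIsUnit (X * M) hu)) h
  rwa [subst_comp_subst_apply hs hi, subst_comp_subst_apply hs hi, key, X_subst, X_subst] at h2

theorem mk_eq_cumulantSeries_subst {m : ℕ → ℂ} (h0 : m 0 = 1) :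
    mk m = (cumulantSeries (freeCumulantOfMoments m)).subst (X * mk m) := by
  have : m = ncSum (freeCumulantOfMoments m) (freeCumulantOfMoments m) 0 := by
    funext n
    rcases Nat.eq_zero_or_pos n with rfl | hn
    · rw [h0, ncSum_empty]
    · rw [← sum_NC_eq_ncSum, ← moment_eq_sum_freeCumulantOfMoments m n hn]
  have h := mk_ncSum_eq_subst (freeCumulantOfMoments m)
  rwa [← this] at h

theorem freeCumulantOfMoments_eq {m κ : ℕ → ℂ} (h0 : m 0 = 1)
    (h : mk m = (cumulantSeries κ).subst (X * mk m)) {n : ℕ} (hn : 1 ≤ n) :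
    freeCumulantOfMoments m n = κ n := by
  have hM : constantCoeff (mk m) = 1 := by simpa using h0
  have hc := subst_X_mul_injective hM ((mk_eq_cumulantSeries_subst h0).symm.trans h)
  have hcoeff := congrArg (coeff n) hc
  have hn' : n ≠ 0 := by omega
  simpa [cumulantSeries, tailSeries, coeff_one, hn'] using hcoeff

end FunctionalEquation

/-! ### The convolution power at the level of series -/

section ConvolutionPower

open PowerSeries

theorem exists_eq_one_add_X_mul {R : Type*} [CommRing R] {f : R⟦X⟧} (hf : constantCoeff f = 1) :
    ∃ B, f = 1 + X * B := by
  obtain ⟨B, hB⟩ := X_dvd_iff.2 (show constantCoeff (f - 1) = 0 by simp [hf])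
  exact ⟨B, by rw [← hB]; ring⟩

theorem exists_mul_one_sub_eq_one {P : ℝ⟦X⟧} (hP : constantCoeff P = 1) :
    ∃ B, P * (1 - X * B) = 1 := by
  have hinv : constantCoeff P⁻¹ = 1 := by rw [constantCoeff_inv, hP, inv_one]
  obtain ⟨B, hB⟩ := exists_eq_one_add_X_mul hinv
  refine ⟨-B, ?_⟩
  rw [mul_neg, sub_neg_eq_add, ← hB]
  exact PowerSeries.mul_inv_cancel P (by rw [hP]; exact one_ne_zero)

/-- The `k`-fold iterate of `f ↦ G`, `G = f(X G)`, solves `G = f(X G ^ k)`. -/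
theorem IsStieltjes.exists_eq_subst_pow {B : ℝ⟦X⟧} (hB : IsStieltjes B) (k : ℕ) :
    ∃ G B' : ℝ⟦X⟧, G = 1 + X * B' ∧ IsStieltjes B' ∧
      G = (1 + X * B).subst (X * G ^ k) ∧ (1 ≤ k → IsStieltjes G) := by
  induction k with
  -- For `k = 0` the equation says `G = 1 + X * B`, where only `B' = B` is known to be Stieltjes.
  | zero => exact ⟨1 + X * B, B, rfl, hB, by simp, by simp⟩
  | succ k ih =>
    obtain ⟨G, B', rfl, hB', hG, -⟩ := ih
    obtain ⟨G', hG', hG'1⟩ := exists_eq_subst (show constantCoeff (1 + X * B') = 1 by simp)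
    have hS := hB'.of_subst hG'
    obtain ⟨B'', rfl⟩ := exists_eq_one_add_X_mul hG'1
    refine ⟨_, B'', rfl, hS.of_one_add_X_mul, ?_, fun _ => hS⟩
    have hs := hasSubst_X_mul (1 + X * B'')
    -- With `f = 1 + X B` and `G'` the new series: `G' = G(X G') = f(X G' · G(X G') ^ k) = f(X G' ^
    -- (k + 1))`.
    conv_lhs => rw [hG', hG, subst_comp_subst_apply (hasSubst_X_mul _) hs, subst_mul hs,
      subst_X hs, subst_pow hs, ← hG', mul_assoc, ← pow_succ']

/-- Existence and positivity of the `t`-th convolution power on the level of the series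
`∑ m_{kn} X ^ n`. -/
theorem IsStieltjes.exists_power {P : ℝ⟦X⟧} (hP : IsStieltjes P) (hP1 : constantCoeff P = 1)
    {k : ℕ} (hk : 1 ≤ k) {t : ℝ} (ht : 1 < t) :
    ∃ G Q : ℝ⟦X⟧, IsStieltjes Q ∧ constantCoeff Q = 1 ∧ Q = G * P.subst (X * G ^ k) ∧
      Q = 1 + C t * (P.subst (X * G ^ k) - 1) := by
  obtain ⟨B, hB⟩ := exists_mul_one_sub_eq_one hP1
  have hBS := hP.of_inv hB
  -- The factor `t - 1` must be nonnegative here; this is where `t > 1` enters the positivity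
  -- argument.
  obtain ⟨G, B', hGB, -, hG, hGS⟩ :=
    (hBS.smul (sub_nonneg.2 ht.le)).exists_eq_subst_pow k
  have hGS := hGS hk
  obtain ⟨B₁, hB₁⟩ := exists_mul_one_sub_eq_one (show constantCoeff G = 1 by simp [hGB])
  have hB₁S := hGS.of_inv hB₁
  have hs := hasSubst_X_mul (G ^ k)
  have hp := congrArg (subst (X * G ^ k)) hB
  rw [subst_mul hs, subst_sub hs, subst_mul hs, one_subst hs, subst_X hs] at hp
  rw [subst_add hs, subst_mul hs, subst_mul hs, one_subst hs, subst_X hs, C_subst] at hG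
  set p := P.subst (X * G ^ k)
  set b := B.subst (X * G ^ k)
  have ht0 : t - 1 ≠ 0 := by linarith
  have hC : (C (t - 1) : ℝ⟦X⟧) = C t - 1 := by simp
  have hτ : (C (t / (t - 1)) : ℝ⟦X⟧) * (C t - 1) = C t := by
    rw [← hC, ← map_mul, div_mul_cancel₀ _ ht0]
  have hpG : p * (C t - G) = C t - 1 := by
    rw [hC] at hG
    linear_combination (C t - 1) * hp - p * hG
  -- By `hpG`, `1 / (G p) = (t / G - 1) / (t - 1)`; insert `1 / G = 1 - X B₁`.
  have hQ : G * p * (1 - X * (C (t / (t - 1)) * B₁)) = 1 := by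
    have hne : (C t - 1 : ℝ⟦X⟧) ≠ 0 := by
      rw [← hC]
      intro h
      exact ht0 (by simpa using congrArg constantCoeff h)
    apply mul_left_cancel₀ hne
    linear_combination hpG + (C t) * p * hB₁ - (X * B₁ * G * p) * hτ
  refine ⟨G, G * p, (hB₁S.smul (by positivity [sub_pos.2 ht])).of_mul_one_sub hQ, ?_, rfl, ?_⟩
  · simpa using congrArg constantCoeff hQ
  · linear_combination -hpG

theorem mk_dvd_eq_subst_X_pow {k : ℕ} (hk : k ≠ 0) (P : ℝ⟦X⟧) :
    (mk fun n => if k ∣ n then ((coeff (n / k) P : ℝ) : ℂ) else 0)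
      = (P.map Complex.ofRealHom).subst (X ^ k : ℂ⟦X⟧) := by
  ext n
  rw [coeff_mk, coeff_subst_X_pow hk]
  simp

/-- The series `z G(z ^ k)` acts as subordination function: composing the moment series of `m` with
it gives the cumulant series of `m` evaluated at `z` times the moment series of `m'`. -/
theorem freeCumulantOfMoments_power {k : ℕ} (hk : 1 ≤ k) {P Q G : ℝ⟦X⟧} {t : ℝ}
    (hP1 : constantCoeff P = 1) (hQ1 : constantCoeff Q = 1)
    (hQG : Q = G * P.subst (X * G ^ k)) (hQt : Q = 1 + C t * (P.subst (X * G ^ k) - 1))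
    {m m' : ℕ → ℂ} (hm : ∀ n, m n = if k ∣ n then ((coeff (n / k) P : ℝ) : ℂ) else 0)
    (hm' : ∀ n, m' n = if k ∣ n then ((coeff (n / k) Q : ℝ) : ℂ) else 0) {n : ℕ} (hn : 1 ≤ n) :
    freeCumulantOfMoments m' n = t * freeCumulantOfMoments m n := by
  have hk0 : k ≠ 0 := by omega
  have hm0 : m 0 = 1 := by simp [hm, hP1]
  have hm'0 : m' 0 = 1 := by simp [hm', hQ1]
  refine freeCumulantOfMoments_eq (κ := fun n => t * freeCumulantOfMoments m n) hm'0 ?_ hn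
  have hM : mk m = (P.map Complex.ofRealHom).subst (X ^ k : ℂ⟦X⟧) := by
    rw [← mk_dvd_eq_subst_X_pow hk0]
    exact congrArg mk (funext hm)
  have hM' : mk m' = (Q.map Complex.ofRealHom).subst (X ^ k : ℂ⟦X⟧) := by
    rw [← mk_dvd_eq_subst_X_pow hk0]
    exact congrArg mk (funext hm')
  have hC := mk_eq_cumulantSeries_subst hm0
  have hsk : HasSubst (X ^ k : ℂ⟦X⟧) := HasSubst.X_pow hk0
  have hsG := hasSubst_X_mul (G ^ k)
  have hmapP : PowerSeries.map Complex.ofRealHom (P.subst (X * G ^ k))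
      = (P.map Complex.ofRealHom).subst (X * (G.map Complex.ofRealHom) ^ k) := by
    have h := map_subst (h := Complex.ofRealHom) hsG P
    have hX : MvPowerSeries.map Complex.ofRealHom (X * G ^ k)
        = X * (G.map Complex.ofRealHom) ^ k := by
      change PowerSeries.map Complex.ofRealHom (X * G ^ k) = _
      rw [map_mul, map_pow, map_X]
    rw [hX] at h
    exact h
  set GC := (G.map Complex.ofRealHom).subst (X ^ k : ℂ⟦X⟧) with hGC
  set p := (P.map Complex.ofRealHom).subst (X ^ k * GC ^ k) with hp
  have hpp : (PowerSeries.map Complex.ofRealHom (P.subst (X * G ^ k))).subst (X ^ k : ℂ⟦X⟧) = p := by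
    rw [hmapP, subst_comp_subst_apply (hasSubst_X_mul _) hsk, subst_mul hsk, subst_X hsk,
      subst_pow hsk]
  have e1 : mk m' = GC * p := by
    rw [hM', hQG, map_mul, subst_mul hsk, hpp]
  have e2 : mk m' = 1 + C (t : ℂ) * (p - 1) := by
    rw [hM', hQt, map_add, map_mul, map_sub, map_one, map_C, subst_add hsk, subst_mul hsk,
      subst_sub hsk, hpp, one_subst hsk, C_subst]
    rfl
  have hz := hasSubst_X_mul GC
  have e3 : (mk m).subst (X * GC) = p := by
    rw [hM, subst_comp_subst_apply hsk hz, subst_pow hz, subst_X hz, mul_pow]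
  have e4 : p = (cumulantSeries (freeCumulantOfMoments m)).subst (X * mk m') := by
    rw [e1, ← e3]
    conv_lhs => rw [hC, subst_comp_subst_apply (hasSubst_X_mul _) hz, subst_mul hz, subst_X hz]
    rw [mul_assoc]
  have hcum : cumulantSeries (fun n => (t : ℂ) * freeCumulantOfMoments m n)
      = 1 + C (t : ℂ) * (cumulantSeries (freeCumulantOfMoments m) - 1) := by
    ext n
    rcases n with _ | n <;> simp [cumulantSeries, tailSeries]
  have hs' := hasSubst_X_mul (mk m')
  rw [hcum, subst_add hs', subst_mul hs', subst_sub hs', one_subst hs', C_subst, ← e4]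
  exact e2

end ConvolutionPower

/-! ### Functionals positive on polynomials nonnegative on the half-line -/

section PositiveFunctionals

open Polynomial Set Filter Topology

/-- Dividing by a factor vanishing at `x₀` loses the sign there; continuity from the right restores
it. -/
theorem Polynomial.eval_nonneg_of_ne {s : ℝ[X]} {x₀ : ℝ}
    (h : ∀ x, 0 ≤ x → x ≠ x₀ → 0 ≤ s.eval x) (x : ℝ) (hx : 0 ≤ x) : 0 ≤ s.eval x := by
  have hcl : IsClosed {x : ℝ | 0 ≤ s.eval x} := isClosed_le continuous_const s.continuous
  by_cases hne : x = x₀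
  · subst hne
    have hsub : closure (Ioi x) ⊆ {x : ℝ | 0 ≤ s.eval x} :=
      hcl.closure_subset_iff.2 fun y hy => h y (hx.trans (le_of_lt hy)) (ne_of_gt hy)
    rw [closure_Ioi] at hsub
    exact hsub self_mem_Ici
  · exact h x hx hne

theorem Polynomial.exists_isMinOn_Ici {p : ℝ[X]} (hp : ∀ x, 0 ≤ x → 0 ≤ p.eval x)
    (hdeg : 0 < p.natDegree) : ∃ x₀, 0 ≤ x₀ ∧ ∀ x, 0 ≤ x → p.eval x₀ ≤ p.eval x := by
  have ht := p.abs_tendsto_atTop (natDegree_pos_iff_degree_pos.1 hdeg)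
  obtain ⟨R, hR⟩ :=
    ((ht.eventually_ge_atTop (p.eval 0)).and (eventually_ge_atTop 0)).exists_forall_of_atTop
  have hR0 : 0 ≤ R := (hR R le_rfl).2
  obtain ⟨x₀, hx₀, hmin⟩ := isCompact_Icc.exists_isMinOn (nonempty_Icc.2 hR0)
    p.continuous.continuousOn
  refine ⟨x₀, hx₀.1, fun x hx => ?_⟩
  rcases le_total x R with hxR | hxR
  · exact hmin ⟨hx, hxR⟩
  · have h1 := (hR x hxR).1
    rw [abs_of_nonneg (hp x hx)] at h1
    exact (hmin ⟨le_rfl, hR0⟩ : p.eval x₀ ≤ p.eval 0).trans h1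

/-- A functional on polynomials which is nonnegative on the squares `q²` and on `X q²` is
nonnegative on all polynomials which are nonnegative on `[0, ∞)`. -/
theorem Polynomial.functional_nonneg (n : ℕ) :
    ∀ (L : ℝ[X] →ₗ[ℝ] ℝ), (∀ q, 0 ≤ L (q * q)) → (∀ q, 0 ≤ L (X * (q * q))) →
      ∀ p : ℝ[X], p.natDegree = n → (∀ x, 0 ≤ x → 0 ≤ p.eval x) → 0 ≤ L p := by
  have hconst : ∀ L : ℝ[X] →ₗ[ℝ] ℝ, (∀ q, 0 ≤ L (q * q)) → ∀ c : ℝ, 0 ≤ c → 0 ≤ L (C c) := by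
    intro L hL c hc
    have := hL (C √c)
    rwa [← C_mul, Real.mul_self_sqrt hc] at this
  induction n using Nat.strong_induction_on with
  | _ n ih =>
    intro L h0 h1 p hpn hp
    rcases Nat.eq_zero_or_pos n with rfl | hn
    · rw [eq_C_of_natDegree_eq_zero hpn] at hp ⊢
      exact hconst L h0 _ (by simpa using hp 0 le_rfl)
    -- Subtracting the minimum creates a root, and splitting it off lowers the degree.
    obtain ⟨x₀, hx₀, hmin⟩ := exists_isMinOn_Ici hp (hpn ▸ hn)
    set m := p.eval x₀ with hm
    obtain ⟨r, hr⟩ : X - C x₀ ∣ p - C m := dvd_iff_isRoot.2 (by simp [hm])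
    have hpe : p = C m + (X - C x₀) * r := by rw [← hr]; ring
    have hev : ∀ x, 0 ≤ x → 0 ≤ (x - x₀) * r.eval x := fun x hx => by
      have := congrArg (eval x) hr
      simp only [eval_sub, eval_C, eval_mul, eval_X] at this
      rw [← this]
      exact sub_nonneg.2 (hmin x hx)
    have hr0 : r ≠ 0 := by
      rintro rfl
      rw [mul_zero, add_zero] at hpe
      rw [hpe, natDegree_C] at hpn
      omega
    have hdr : p.natDegree = r.natDegree + 1 := by
      rw [← natDegree_sub_C (a := m), hr, natDegree_mul (X_sub_C_ne_zero _) hr0, natDegree_X_sub_C,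
        add_comm]
    have hLm : 0 ≤ L (C m) := hconst L h0 m (hp x₀ hx₀)
    rcases hx₀.eq_or_lt with h00 | hpos
    · rw [← h00] at hpe hev
      simp only [sub_zero, C_0] at hpe hev
      rw [hpe, map_add]
      refine add_nonneg hLm ?_
      -- For a minimum at `0`, `L` composed with multiplication by `X` satisfies the hypotheses
      -- again, with the roles of `q * q` and `X * (q * q)` exchanged.
      refine ih r.natDegree (by omega) (L ∘ₗ LinearMap.mulLeft ℝ X) (fun q => ?_) (fun q => ?_) r rfl
        (eval_nonneg_of_ne (x₀ := 0) fun x hx hne => ?_)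
      · simpa using h1 q
      · have := h0 (X * q)
        simp only [LinearMap.comp_apply, LinearMap.mulLeft_apply]
        convert this using 2
        ring
      · exact nonneg_of_mul_nonneg_right (hev x hx) (lt_of_le_of_ne hx (Ne.symm hne))
    -- An interior minimum is a double root of `p - m`, and multiplication by `(X - x₀) ^ 2`
    -- preserves both hypotheses on `L`.
    · have hroot : r.eval x₀ = 0 := by
        have hloc : IsLocalMin (fun x => p.eval x) x₀ := by
          filter_upwards [Ioi_mem_nhds hpos] with x hx
          exact hmin x (le_of_lt hx)
        have hd := hloc.deriv_eq_zero
        rw [Polynomial.deriv, hpe] at hd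
        simpa using hd
      obtain ⟨s, hs⟩ : X - C x₀ ∣ r := dvd_iff_isRoot.2 hroot
      have hs0 : s ≠ 0 := by
        rintro rfl
        exact hr0 (by rw [hs, mul_zero])
      have hds : r.natDegree = s.natDegree + 1 := by
        rw [hs, natDegree_mul (X_sub_C_ne_zero _) hs0, natDegree_X_sub_C, add_comm]
      have hpe2 : p = C m + (X - C x₀) * (X - C x₀) * s := by
        rw [mul_assoc, ← hs, ← hpe]
      have key : 0 ≤ (L ∘ₗ LinearMap.mulLeft ℝ ((X - C x₀) * (X - C x₀))) s := by
        refine ih s.natDegree (by omega) _ (fun q => ?_) (fun q => ?_) s rfl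
          (eval_nonneg_of_ne (x₀ := x₀) fun x hx hne => ?_)
        · have := h0 ((X - C x₀) * q)
          simp only [LinearMap.comp_apply, LinearMap.mulLeft_apply]
          convert this using 2
          ring
        · have := h1 ((X - C x₀) * q)
          simp only [LinearMap.comp_apply, LinearMap.mulLeft_apply]
          convert this using 2
          ring
        · have := hev x hx
          rw [hs, eval_mul, ← mul_assoc] at this
          simp only [eval_sub, eval_X, eval_C] at this
          exact nonneg_of_mul_nonneg_right this (mul_self_pos.2 (sub_ne_zero.2 hne))
      rw [hpe2, map_add]
      exact add_nonneg hLm key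

end PositiveFunctionals

/-! ### The Stieltjes moment problem -/

section MomentProblem

open Polynomial Set Filter Topology
open scoped NNReal CompactlySupported ENNReal

/-- The pairs `(f, p)` with `f + p ≥ 0` on `[0, ∞)`. -/
def nonnegPairs : PointedCone ℝ (C_c(ℝ≥0, ℝ) × ℝ[X]) where
  carrier := {z | ∀ x : ℝ≥0, 0 ≤ z.1 x + z.2.eval (x : ℝ)}
  add_mem' {z w} hz hw x := by
    have := add_nonneg (hz x) (hw x)
    simp only [Prod.fst_add, Prod.snd_add, CompactlySupportedContinuousMap.add_apply, eval_add]
    linarith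
  zero_mem' x := by simp
  smul_mem' c z hz x := by
    have := mul_nonneg c.2 (hz x)
    have hc : c • z = (c : ℝ) • z := rfl
    rw [hc]
    change 0 ≤ (c : ℝ) * z.1 x + ((c : ℝ) • z.2).eval (x : ℝ)
    rwa [eval_smul, smul_eq_mul, ← mul_add]

theorem mem_nonnegPairs {f : C_c(ℝ≥0, ℝ)} {p : ℝ[X]} :
    (f, p) ∈ nonnegPairs ↔ ∀ x : ℝ≥0, 0 ≤ f x + p.eval (x : ℝ) := Iff.rfl

/-- A positive functional on polynomials extends to compactly supported functions. -/
theorem exists_positive_extension (L : ℝ[X] →ₗ[ℝ] ℝ)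
    (hL : ∀ p : ℝ[X], (∀ x, 0 ≤ x → 0 ≤ p.eval x) → 0 ≤ L p) :
    ∃ g : (C_c(ℝ≥0, ℝ) × ℝ[X]) →ₗ[ℝ] ℝ, (∀ p, g (0, p) = L p) ∧ ∀ z ∈ nonnegPairs, 0 ≤ g z := by
  let F : (C_c(ℝ≥0, ℝ) × ℝ[X]) →ₗ.[ℝ] ℝ :=
    { domain := Submodule.prod ⊥ ⊤
      toFun := (L ∘ₗ LinearMap.snd ℝ _ _) ∘ₗ (Submodule.prod ⊥ ⊤).subtype }
  have hF : ∀ x : F.domain, F x = L (x : C_c(ℝ≥0, ℝ) × ℝ[X]).2 := fun x => rfl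
  have hdom : ∀ x : F.domain, (x : C_c(ℝ≥0, ℝ) × ℝ[X]).1 = 0 := fun x => x.2.1
  have hmem : ∀ p : ℝ[X], ((0, p) : C_c(ℝ≥0, ℝ) × ℝ[X]) ∈ F.domain := fun p => ⟨rfl, trivial⟩
  have hnonneg : ∀ x : F.domain, (x : C_c(ℝ≥0, ℝ) × ℝ[X]) ∈ nonnegPairs → 0 ≤ F x := by
    intro x hx
    rw [hF]
    refine hL _ fun y hy => ?_
    have := hx ⟨y, hy⟩
    have hzero : (0 : C_c(ℝ≥0, ℝ)) ⟨y, hy⟩ = 0 := rfl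
    rwa [hdom x, hzero, zero_add] at this
  -- Majorization hypothesis of the M. Riesz extension theorem: `C c - p` cancels the polynomial and
  -- outweighs `f`, which is bounded by `c`.
  have hdense : ∀ y, ∃ x : F.domain, (x : C_c(ℝ≥0, ℝ) × ℝ[X]) + y ∈ nonnegPairs := by
    rintro ⟨f, p⟩
    obtain ⟨c, hc⟩ := f.hasCompactSupport.exists_bound_of_continuous f.continuous
    refine ⟨⟨_, hmem (C c - p)⟩, fun x => ?_⟩
    have := neg_le_of_abs_le (hc x)
    simp
    linarith
  obtain ⟨g, hg, hpos⟩ := riesz_extension nonnegPairs F hnonneg hdense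
  exact ⟨g, fun p => by rw [hg ⟨_, hmem p⟩, hF], hpos⟩

/-- The continuous cutoff of `x ^ n` between `R` and `R + 1`. -/
noncomputable def cutoffPow (n R : ℕ) : C_c(ℝ≥0, ℝ) where
  toFun x := (x : ℝ) ^ n * max 0 (min 1 (R + 1 - (x : ℝ)))
  continuous_toFun := by fun_prop
  hasCompactSupport' := by
    refine HasCompactSupport.intro (K := Icc 0 (R + 1 : ℝ≥0)) isCompact_Icc fun x hx => ?_
    have h : (R : ℝ) + 1 < x := by
      by_contra h
      push Not at h
      exact hx ⟨zero_le, by exact_mod_cast h⟩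
    have : min 1 ((R : ℝ) + 1 - (x : ℝ)) ≤ 0 := (min_le_right _ _).trans (by linarith)
    rw [max_eq_left this, mul_zero]

theorem cutoffPow_apply (n R : ℕ) (x : ℝ≥0) :
    cutoffPow n R x = (x : ℝ) ^ n * max 0 (min 1 (R + 1 - (x : ℝ))) := rfl

theorem cutoffPow_nonneg (n R : ℕ) (x : ℝ≥0) : 0 ≤ cutoffPow n R x :=
  mul_nonneg (by positivity) (le_max_left _ _)

theorem cutoffPow_le (n R : ℕ) (x : ℝ≥0) : cutoffPow n R x ≤ (x : ℝ) ^ n :=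
  mul_le_of_le_one_right (by positivity) (max_le zero_le_one (min_le_left _ _))

theorem cutoffPow_eq {n R : ℕ} {x : ℝ≥0} (h : (x : ℝ) ≤ R) : cutoffPow n R x = (x : ℝ) ^ n := by
  rw [cutoffPow_apply, min_eq_left (by linarith), max_eq_right zero_le_one, mul_one]

theorem cutoffPow_mono (n : ℕ) (x : ℝ≥0) : Monotone fun R => cutoffPow n R x := by
  intro R R' h
  have : (R : ℝ) ≤ R' := by exact_mod_cast h
  simp only [cutoffPow_apply]
  gcongr

/-- Existence of a solution of the Stieltjes moment problem for a positive functional. -/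
theorem exists_measure_of_functional (L : ℝ[X] →ₗ[ℝ] ℝ)
    (hL : ∀ p : ℝ[X], (∀ x, 0 ≤ x → 0 ≤ p.eval x) → 0 ≤ L p) :
    ∃ σ : Measure ℝ≥0, ∀ n : ℕ, Integrable (fun x : ℝ≥0 => (x : ℝ) ^ n) σ ∧
      ∫ x, (x : ℝ) ^ n ∂σ = L (X ^ n) := by
  obtain ⟨g, hg, hpos⟩ := exists_positive_extension L hL
  let Λ : C_c(ℝ≥0, ℝ) →ₚ[ℝ] ℝ :=
    PositiveLinearMap.mk₀ (g ∘ₗ LinearMap.inl ℝ _ _) fun f hf =>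
      hpos _ (mem_nonnegPairs.2 fun x => by simpa using hf x)
  have hΛ : ∀ f, Λ f = g (f, 0) := fun f => rfl
  refine ⟨RealRMK.rieszMeasure Λ, fun n => ?_⟩
  set σ := RealRMK.rieszMeasure Λ
  have hLn : 0 ≤ L (X ^ n) := hL _ fun x hx => by simpa using pow_nonneg hx n
  have hint : ∀ R, ∫ x, cutoffPow n R x ∂σ = g (cutoffPow n R, 0) := fun R => by
    rw [RealRMK.integral_rieszMeasure, hΛ]
  have hupper : ∀ R, g (cutoffPow n R, 0) ≤ L (X ^ n) := fun R => by
    have h : 0 ≤ g ((0, X ^ n) - (cutoffPow n R, 0)) := by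
      refine hpos _ fun x => ?_
      have := cutoffPow_le n R x
      simp
      linarith
    rw [map_sub, hg] at h
    linarith
  -- Beyond `R + 1` one has `x ^ n ≤ x ^ (n + 1) / (R + 1)`, so the next moment prevents mass from
  -- escaping to infinity.
  have hlower : ∀ R : ℕ, L (X ^ n) - L (X ^ (n + 1)) * ((R : ℝ) + 1)⁻¹
      ≤ g (cutoffPow n (R + 1), 0) := fun R => by
    have h : 0 ≤ g ((cutoffPow n (R + 1), 0) + ((R : ℝ) + 1)⁻¹ • (0, X ^ (n + 1)) - (0, X ^ n)) := by
      refine hpos _ fun x => ?_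
      have hR : (0 : ℝ) < (R : ℝ) + 1 := by positivity
      have h1 : 0 ≤ cutoffPow n (R + 1) x + ((R : ℝ) + 1)⁻¹ * (x : ℝ) ^ (n + 1) - (x : ℝ) ^ n := by
        rcases le_total (x : ℝ) (R + 1) with hx | hx
        · rw [cutoffPow_eq (by push_cast; exact hx)]
          have : 0 ≤ ((R : ℝ) + 1)⁻¹ * (x : ℝ) ^ (n + 1) := by positivity
          linarith
        · have h2 := cutoffPow_nonneg n (R + 1) x
          have h3 : (x : ℝ) ^ n ≤ ((R : ℝ) + 1)⁻¹ * (x : ℝ) ^ (n + 1) := by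
            rw [pow_succ, mul_comm, mul_assoc]
            refine le_mul_of_one_le_right (by positivity) ?_
            rw [← div_eq_mul_inv]
            exact (one_le_div hR).2 hx
          linarith
      simpa [add_sub_assoc, add_assoc] using h1
    rw [map_sub, map_add, map_smul, hg, hg, smul_eq_mul] at h
    linarith
  have hconv : Tendsto (fun R : ℕ => g (cutoffPow n R, 0)) atTop (𝓝 (L (X ^ n))) := by
    rw [← tendsto_add_atTop_iff_nat 1]
    refine tendsto_of_tendsto_of_tendsto_of_le_of_le ?_ tendsto_const_nhds hlower
      fun R => hupper (R + 1)
    have h := (tendsto_one_div_add_atTop_nhds_zero_nat (𝕜 := ℝ)).const_mul (L (X ^ (n + 1)))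
    simpa using h.const_sub (L (X ^ n))
  have hmono := lintegral_tendsto_of_tendsto_of_monotone (μ := σ)
    (f := fun R x => ENNReal.ofReal (cutoffPow n R x)) (F := fun x => ENNReal.ofReal ((x : ℝ) ^ n))
    (fun R => ((cutoffPow n R).continuous.measurable.ennreal_ofReal).aemeasurable)
    (ae_of_all _ fun x R R' h => ENNReal.ofReal_le_ofReal (cutoffPow_mono n x h))
    (ae_of_all _ fun x => by
      refine tendsto_const_nhds.congr' ?_
      filter_upwards [eventually_ge_atTop ⌈(x : ℝ)⌉₊] with R hR
      rw [cutoffPow_eq (Nat.ceil_le.1 hR)])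
  have hof : ∀ R, ∫⁻ x, ENNReal.ofReal (cutoffPow n R x) ∂σ
      = ENNReal.ofReal (g (cutoffPow n R, 0)) := fun R => by
    rw [← hint, ofReal_integral_eq_lintegral_ofReal]
    · exact (cutoffPow n R).continuous.integrable_of_hasCompactSupport
        (cutoffPow n R).hasCompactSupport
    · exact ae_of_all _ fun x => cutoffPow_nonneg n R x
  simp only [hof] at hmono
  have hlin : ∫⁻ x : ℝ≥0, ENNReal.ofReal ((x : ℝ) ^ n) ∂σ = ENNReal.ofReal (L (X ^ n)) :=
    tendsto_nhds_unique hmono (ENNReal.tendsto_ofReal hconv)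
  have hmeas : Measurable fun x : ℝ≥0 => (x : ℝ) ^ n := by fun_prop
  have hnn : 0 ≤ᵐ[σ] fun x : ℝ≥0 => (x : ℝ) ^ n := ae_of_all _ fun x => by positivity
  refine ⟨⟨hmeas.aestronglyMeasurable, ?_⟩, ?_⟩
  · rw [hasFiniteIntegral_iff_ofReal hnn, hlin]
    exact ENNReal.ofReal_lt_top
  · rw [integral_eq_lintegral_of_nonneg_ae hnn hmeas.aestronglyMeasurable, hlin,
      ENNReal.toReal_ofReal hLn]

end MomentProblem

/-! ### Stieltjes series and measures on the half-line -/

section StieltjesMeasures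

open Kernel

/-- A kernel with nonnegative quadratic forms is positive semidefinite. -/
theorem Kernel.isPSD_of_quadraticForm {K : Kernel} {a : ℕ → ℕ → ℝ} (hsymm : ∀ i j, a i j = a j i)
    (hK : ∀ e : Fin 2 →₀ ℕ, MvPowerSeries.coeff e K = a (e 0) (e 1))
    (h : ∀ (N : ℕ) (c : Fin N → ℝ), 0 ≤ ∑ i, ∑ j, c i * c j * a i j) : IsPSD K := by
  intro N
  have hA : (Matrix.of fun i j : Fin N => a i j).PosSemidef := by
    refine .of_dotProduct_mulVec_nonneg ?_ fun c => ?_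
    · ext i j
      simpa using hsymm j i
    · have := h N c
      simp only [dotProduct, Matrix.mulVec, Matrix.of_apply, Finset.mul_sum, star_trivial]
      refine this.trans_eq (Finset.sum_congr rfl fun i _ => Finset.sum_congr rfl fun j _ => ?_)
      ring
  -- The vectors of the rank-one decomposition, padded by zeros, serve as Gram series.
  obtain ⟨m, v, hv⟩ := Matrix.posSemidef_iff_eq_sum_vecMulVec.1 hA
  refine ⟨Fin m, inferInstance,
    fun l => PowerSeries.mk fun n => if hn : n < N then v l ⟨n, hn⟩ else 0, fun e h0 h1 => ?_⟩
  have := congrFun (congrFun hv ⟨e 0, h0⟩) ⟨e 1, h1⟩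
  rw [Matrix.sum_apply] at this
  rw [hK, coeff_gram]
  simpa [Matrix.vecMulVec_apply, h0, h1] using this

/-- The moments of a weighted nonnegative random variable form a positive semidefinite kernel. -/
theorem Kernel.isPSD_of_integral {Ω : Type*} [MeasurableSpace Ω] {μ : Measure Ω} {w h : Ω → ℝ}
    (hw : ∀ x, 0 ≤ w x) (hint : ∀ n : ℕ, Integrable (fun x => w x * h x ^ n) μ) {K : Kernel}
    (hK : ∀ e : Fin 2 →₀ ℕ, MvPowerSeries.coeff e K = ∫ x, w x * h x ^ (e 0 + e 1) ∂μ) :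
    IsPSD K := by
  refine isPSD_of_quadraticForm (a := fun i j => ∫ x, w x * h x ^ (i + j) ∂μ)
    (fun i j => by simp only [add_comm]) hK fun N c => ?_
  have hI : ∀ i j : Fin N, Integrable (fun x => c i * c j * (w x * h x ^ ((i : ℕ) + j))) μ :=
    fun i j => (hint _).const_mul _
  simp only [← integral_const_mul]
  have : ∑ i, ∑ j, ∫ x, c i * c j * (w x * h x ^ ((i : ℕ) + j)) ∂μ
      = ∫ x, w x * (∑ i, c i * h x ^ (i : ℕ)) ^ 2 ∂μ := by
    simp only [← integral_finsetSum _ fun j _ => hI _ j]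
    rw [← integral_finsetSum _ fun i _ => integrable_finsetSum _ fun j _ => hI i j]
    congr 1
    funext x
    rw [sq, Finset.sum_mul_sum, Finset.mul_sum]
    refine Finset.sum_congr rfl fun i _ => ?_
    rw [Finset.mul_sum]
    refine Finset.sum_congr rfl fun j _ => ?_
    rw [pow_add]
    ring
  rw [this]
  exact integral_nonneg fun x => mul_nonneg (hw x) (sq_nonneg _)

/-- The weights `1` and `h` produce the two Hankel kernels. -/
theorem isStieltjes_mk_integral {Ω : Type*} [MeasurableSpace Ω] {μ : Measure Ω} {h : Ω → ℝ}
    (hh : ∀ x, 0 ≤ h x) (hint : ∀ n : ℕ, Integrable (fun x => h x ^ n) μ) :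
    IsStieltjes (PowerSeries.mk fun n => ∫ x, h x ^ n ∂μ) where
  hankel := isPSD_of_integral (μ := μ) (h := h) (w := 1) (fun _ => zero_le_one) (by simpa using hint) fun e => by
    rw [coeff_dividedDiff, PowerSeries.coeff_succ_X_mul]
    simp
  shifted := isPSD_of_integral (μ := μ) (h := h) (w := h) hh
    (fun n => by simpa only [← pow_succ'] using hint (n + 1)) fun e => by
      simp only [coeff_dividedDiff, PowerSeries.coeff_mk, ← pow_succ']

open Polynomial in
/-- The functional `X ^ n ↦ a n` on polynomials. -/
noncomputable def momentFunctional (a : ℕ → ℝ) : ℝ[X] →ₗ[ℝ] ℝ :=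
  Polynomial.lsum fun n => a n • LinearMap.id

theorem momentFunctional_monomial (a : ℕ → ℝ) (n : ℕ) (c : ℝ) :
    momentFunctional a (Polynomial.monomial n c) = c * a n := by
  rw [momentFunctional, Polynomial.lsum_apply, Polynomial.sum_monomial_index]
  · simp [mul_comm]
  · simp

-- Inserting the Gram decomposition turns the value into a sum of squares. The cases `s = 0` and `s
-- = 1` serve the two Hankel kernels.
open Polynomial in
theorem momentFunctional_nonneg {a : ℕ → ℝ} {s : ℕ} {K : Kernel} (hK : IsPSD K)
    (ha : ∀ e : Fin 2 →₀ ℕ, MvPowerSeries.coeff e K = a (s + (e 0 + e 1))) (q : ℝ[X]) :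
    0 ≤ momentFunctional a (X ^ s * (q * q)) := by
  obtain ⟨ι, _, f, hf⟩ := hK (q.natDegree + 1)
  set N := q.natDegree + 1 with hN
  have hq : q = ∑ i ∈ Finset.range N, monomial i (q.coeff i) := q.as_sum_range
  have hexp : X ^ s * (q * q) = ∑ i ∈ Finset.range N, ∑ j ∈ Finset.range N,
      monomial (s + (i + j)) (q.coeff i * q.coeff j) := by
    conv_lhs => rw [hq, Finset.sum_mul_sum, Finset.mul_sum]
    refine Finset.sum_congr rfl fun i _ => ?_
    rw [Finset.mul_sum]
    refine Finset.sum_congr rfl fun j _ => ?_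
    rw [monomial_mul_monomial, ← monomial_one_right_eq_X_pow, monomial_mul_monomial, one_mul]
  have hentry : ∀ i ∈ Finset.range N, ∀ j ∈ Finset.range N,
      a (s + (i + j)) = ∑ l, PowerSeries.coeff i (f l) * PowerSeries.coeff j (f l) := by
    intro i hi j hj
    rw [Finset.mem_range] at hi hj
    have := hf (Finsupp.single 0 i + Finsupp.single 1 j) (by simpa using hi) (by simpa using hj)
    rw [ha, coeff_gram] at this
    simpa using this
  rw [hexp, map_sum]
  have : ∑ i ∈ Finset.range N, momentFunctional a (∑ j ∈ Finset.range N,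
      monomial (s + (i + j)) (q.coeff i * q.coeff j))
      = ∑ l, (∑ i ∈ Finset.range N, q.coeff i * PowerSeries.coeff i (f l)) ^ 2 := by
    simp only [sq, Finset.sum_mul_sum]
    rw [Finset.sum_comm]
    refine Finset.sum_congr rfl fun i hi => ?_
    rw [map_sum, Finset.sum_comm]
    refine Finset.sum_congr rfl fun j hj => ?_
    rw [momentFunctional_monomial, hentry i hi j hj, Finset.mul_sum]
    refine Finset.sum_congr rfl fun l _ => ?_
    ring
  rw [this]
  exact Finset.sum_nonneg fun l _ => sq_nonneg _

open scoped NNReal in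
/-- A Stieltjes series is the moment generating series of a measure on `[0, ∞)`. -/
theorem IsStieltjes.exists_measure {f : PowerSeries ℝ} (hf : IsStieltjes f) :
    ∃ σ : Measure ℝ≥0, ∀ n : ℕ, Integrable (fun x : ℝ≥0 => (x : ℝ) ^ n) σ ∧
      ∫ x, (x : ℝ) ^ n ∂σ = PowerSeries.coeff n f := by
  have h0 : ∀ q, 0 ≤ momentFunctional (fun n => PowerSeries.coeff n f) (q * q) := fun q => by
    have := momentFunctional_nonneg (a := fun n => PowerSeries.coeff n f) (s := 0) hf.hankel
      (fun e => by rw [coeff_dividedDiff, PowerSeries.coeff_succ_X_mul, zero_add]) q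
    simpa using this
  have h1 : ∀ q, 0 ≤ momentFunctional (fun n => PowerSeries.coeff n f) (Polynomial.X * (q * q)) :=
    fun q => by
      have := momentFunctional_nonneg (a := fun n => PowerSeries.coeff n f) (s := 1) hf.shifted
        (fun e => by rw [coeff_dividedDiff, add_comm]) q
      simpa using this
  obtain ⟨σ, hσ⟩ := exists_measure_of_functional _
    fun p hp => Polynomial.functional_nonneg _ _ h0 h1 p rfl hp
  refine ⟨σ, fun n => ⟨(hσ n).1, ?_⟩⟩
  rw [(hσ n).2, ← Polynomial.monomial_one_right_eq_X_pow, momentFunctional_monomial, one_mul]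

end StieltjesMeasures

/-! ### Moments and construction of `k`-symmetric measures -/

section KSymmetric

open Complex

theorem isPrimitiveRoot_rotation {k : ℕ} (hk : 1 ≤ k) :
    IsPrimitiveRoot (exp (2 * Real.pi * I / k)) k :=
  Complex.isPrimitiveRoot_exp k (by omega)

theorem norm_rotation {k : ℕ} (hk : 1 ≤ k) : ‖exp (2 * Real.pi * I / k)‖ = 1 :=
  (isPrimitiveRoot_rotation hk).norm'_eq_one (by omega)

theorem mem_kSemiaxes_iff {k : ℕ} (hk : 1 ≤ k) {z : ℂ} :
    z ∈ kSemiaxes k ↔ z ^ k = (‖z‖ : ℂ) ^ k := by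
  have hq := isPrimitiveRoot_rotation hk
  constructor
  · rintro ⟨r, hr, s, rfl⟩
    rw [norm_mul, norm_pow, norm_rotation hk, one_pow, mul_one, Complex.norm_of_nonneg hr, mul_pow,
      ← pow_mul, mul_comm s, pow_mul, hq.pow_eq_one, one_pow, mul_one]
  · intro h
    by_cases hz : z = 0
    · exact ⟨0, le_rfl, 0, by simp [hz]⟩
    · have hn : (‖z‖ : ℂ) ≠ 0 := by simpa using hz
      have : NeZero k := ⟨by omega⟩
      obtain ⟨s, -, hs⟩ := hq.eq_pow_of_pow_eq_one
        (show (z / ‖z‖) ^ k = 1 by rw [div_pow, h, div_self (pow_ne_zero _ hn)])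
      exact ⟨‖z‖, norm_nonneg z, s, by rw [hs, mul_div_cancel₀ _ hn]⟩

theorem isClosed_kSemiaxes {k : ℕ} (hk : 1 ≤ k) : IsClosed (kSemiaxes k) := by
  have : kSemiaxes k = {z : ℂ | z ^ k = (‖z‖ : ℂ) ^ k} := Set.ext fun z => mem_kSemiaxes_iff hk
  rw [this]
  exact isClosed_eq (by fun_prop) (by fun_prop)

theorem IsKSymmetric.map_rotation {k : ℕ} {μ : Measure ℂ} (hμ : IsKSymmetric k μ) :
    μ.map (fun z => exp (2 * Real.pi * I / k) * z) = μ := by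
  ext B hB
  have hm : Measurable fun z : ℂ => exp (2 * Real.pi * I / k) * z := by fun_prop
  rw [Measure.map_apply hm hB, ← hμ.rotation_invariant _ (hm hB), Set.image_preimage_eq]
  exact mul_left_surjective₀ (exp_ne_zero _)

/-- Rotation multiplies the `n`-th moment by `q ^ n`, which differs from `1` unless `k ∣ n`; on the
semiaxes `z ^ k = ‖z‖ ^ k`. -/
theorem IsKSymmetric.moment_eq {k : ℕ} (hk : 1 ≤ k) {μ : Measure ℂ} (hμ : IsKSymmetric k μ)
    (n : ℕ) :
    moment μ n = if k ∣ n then ((∫ z, (‖z‖ ^ k) ^ (n / k) ∂μ : ℝ) : ℂ) else 0 := by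
  have hq := isPrimitiveRoot_rotation hk
  have hae : ∀ᵐ z ∂μ, z ∈ kSemiaxes k := hμ.compl_kSemiaxes
  split_ifs with hkn
  · rw [moment, ← integral_complex_ofReal]
    refine integral_congr_ae ?_
    filter_upwards [hae] with z hz
    obtain ⟨d, rfl⟩ := hkn
    rw [Nat.mul_div_cancel_left _ (by omega), pow_mul, (mem_kSemiaxes_iff hk).1 hz]
    push_cast
    rfl
  · have h : moment μ n = exp (2 * Real.pi * I / k) ^ n * moment μ n := by
      conv_lhs => rw [moment, ← hμ.map_rotation,
        integral_map (by fun_prop) (by fun_prop)]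
      simp only [mul_pow]
      rw [integral_const_mul, moment]
    have hne : 1 - exp (2 * Real.pi * I / k) ^ n ≠ 0 := by
      rw [sub_ne_zero]
      exact fun h => hkn ((hq.pow_eq_one_iff_dvd n).1 h.symm)
    have : (1 - exp (2 * Real.pi * I / k) ^ n) * moment μ n = 0 := by linear_combination h
    exact (mul_eq_zero.1 this).resolve_left hne

open scoped NNReal

/-- The `k`-th root of `x` on the `s`-th semiaxis. -/
noncomputable def rootMap (k s : ℕ) (x : ℝ≥0) : ℂ :=
  ((x ^ (1 / k : ℝ) : ℝ≥0) : ℂ) * exp (2 * Real.pi * I / k) ^ s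

/-- The `k`-symmetric measure whose image under `z ↦ z ^ k` is `σ`. -/
noncomputable def kRootMeasure (k : ℕ) (σ : Measure ℝ≥0) : Measure ℂ :=
  (k : ENNReal)⁻¹ • ∑ s ∈ Finset.range k, σ.map (rootMap k s)

theorem measurable_rootMap (k s : ℕ) : Measurable (rootMap k s) := by
  unfold rootMap
  have : Measurable fun x : ℝ≥0 => x ^ (1 / k : ℝ) := by fun_prop
  fun_prop

theorem norm_rootMap_pow {k : ℕ} (hk : 1 ≤ k) (s : ℕ) (x : ℝ≥0) : ‖rootMap k s x‖ ^ k = x := by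
  have hk0 : k ≠ 0 := by omega
  rw [rootMap, norm_mul, norm_pow, norm_rotation hk, one_pow, mul_one]
  have : ‖((x ^ (1 / k : ℝ) : ℝ≥0) : ℂ)‖ = ((x ^ (1 / k : ℝ) : ℝ≥0) : ℝ) :=
    Complex.norm_of_nonneg (NNReal.coe_nonneg _)
  rw [this, ← NNReal.coe_pow, one_div, NNReal.rpow_inv_natCast_pow x hk0]

theorem rootMap_mem {k : ℕ} (s : ℕ) (x : ℝ≥0) : rootMap k s x ∈ kSemiaxes k :=
  ⟨_, NNReal.coe_nonneg _, s, rfl⟩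

theorem rootMap_succ (k s : ℕ) (x : ℝ≥0) :
    rootMap k (s + 1) x = exp (2 * Real.pi * I / k) * rootMap k s x := by
  rw [rootMap, rootMap, pow_succ]
  ring

theorem rootMap_self {k : ℕ} (hk : 1 ≤ k) (x : ℝ≥0) : rootMap k k x = rootMap k 0 x := by
  rw [rootMap, rootMap, (isPrimitiveRoot_rotation hk).pow_eq_one, pow_zero]

theorem isKSymmetric_kRootMeasure {k : ℕ} (hk : 1 ≤ k) (σ : Measure ℝ≥0) [IsProbabilityMeasure σ] :
    IsKSymmetric k (kRootMeasure k σ) where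
  isProbabilityMeasure := by
    constructor
    have : ∀ s, σ.map (rootMap k s) Set.univ = 1 := fun s => by
      rw [Measure.map_apply (measurable_rootMap k s) MeasurableSet.univ, Set.preimage_univ,
        measure_univ]
    simp only [kRootMeasure, Measure.smul_apply, Measure.finsetSum_apply, this, Finset.sum_const,
      Finset.card_range, nsmul_eq_mul, mul_one, smul_eq_mul]
    exact ENNReal.inv_mul_cancel (by simpa using (by omega : k ≠ 0)) (ENNReal.natCast_ne_top k)
  compl_kSemiaxes := by
    have : ∀ s, σ.map (rootMap k s) (kSemiaxes k)ᶜ = 0 := fun s => by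
      rw [Measure.map_apply (measurable_rootMap k s) (isClosed_kSemiaxes hk).measurableSet.compl]
      have : rootMap k s ⁻¹' (kSemiaxes k)ᶜ = ∅ :=
        Set.eq_empty_of_forall_notMem fun x hx => hx (rootMap_mem s x)
      rw [this, measure_empty]
    simp [kRootMeasure, Measure.finsetSum_apply, this]
  rotation_invariant B hB := by
    have hq0 : exp (2 * Real.pi * I / k) ≠ 0 := exp_ne_zero _
    have hinj : Function.Injective fun z : ℂ => exp (2 * Real.pi * I / k) * z :=
      mul_right_injective₀ hq0
    have hemb : MeasurableEmbedding fun z : ℂ => exp (2 * Real.pi * I / k) * z :=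
      (Homeomorph.mulLeft₀ _ hq0).measurableEmbedding
    have hqB : MeasurableSet ((fun z : ℂ => exp (2 * Real.pi * I / k) * z) '' B) :=
      hemb.measurableSet_image.2 hB
    have hstep : ∀ s, σ.map (rootMap k (s + 1)) ((fun z => exp (2 * Real.pi * I / k) * z) '' B)
        = σ.map (rootMap k s) B := fun s => by
      rw [Measure.map_apply (measurable_rootMap k _) hqB,
        Measure.map_apply (measurable_rootMap k _) hB]
      congr 1
      ext x
      rw [Set.mem_preimage, Set.mem_preimage, rootMap_succ]
      exact hinj.mem_set_image
    -- Rotation moves the `s`-th summand to the next one, and `q ^ k = 1` closes the cycle.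
    have hcyc : σ.map (rootMap k k) = σ.map (rootMap k 0) := by
      rw [funext (rootMap_self hk)]
    simp only [kRootMeasure, Measure.smul_apply, Measure.finsetSum_apply]
    congr 1
    obtain ⟨d, rfl⟩ : ∃ d, k = d + 1 := ⟨k - 1, by omega⟩
    rw [Finset.sum_range_succ', ← hcyc, Finset.sum_range_succ _ d]
    simp only [hstep]

theorem integrable_kRootMeasure {k : ℕ} {σ : Measure ℝ≥0} {F : ℂ → ℝ}
    (hk : 1 ≤ k) (h : ∀ s, Integrable F (σ.map (rootMap k s))) :
    Integrable F (kRootMeasure k σ) := by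
  refine Integrable.smul_measure ?_ (ENNReal.inv_ne_top.2 (by simpa using (by omega : k ≠ 0)))
  exact integrable_finsetSum_measure.2 fun s _ => h s

theorem hasAllMoments_kRootMeasure {k : ℕ} (hk : 1 ≤ k) {σ : Measure ℝ≥0} [IsProbabilityMeasure σ]
    (hσ : ∀ n : ℕ, Integrable (fun x : ℝ≥0 => (x : ℝ) ^ n) σ) :
    HasAllMoments (kRootMeasure k σ) := by
  intro n
  refine integrable_kRootMeasure hk fun s => ?_
  rw [integrable_map_measure (by fun_prop) (measurable_rootMap k s).aemeasurable]
  -- With `r = ‖rootMap k s x‖` the bound is `r ^ n ≤ 1 + r ^ (k * n)`, where `r ^ (k * n) = x ^ n`.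
  refine ((integrable_const (1 : ℝ)).add (hσ n)).mono'
    ((measurable_rootMap k s).norm.pow_const n).aestronglyMeasurable
    (Filter.Eventually.of_forall fun x => ?_)
  simp only [Function.comp_apply, Pi.add_apply]
  rw [Real.norm_of_nonneg (by positivity), ← norm_rootMap_pow hk s x, ← pow_mul]
  rcases le_total ‖rootMap k s x‖ 1 with h | h
  · have h1 := pow_le_one₀ (n := n) (norm_nonneg _) h
    have h2 : 0 ≤ ‖rootMap k s x‖ ^ (k * n) := by positivity
    linarith
  · have := pow_le_pow_right₀ h (Nat.le_mul_of_pos_left n hk)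
    linarith

theorem integral_kRootMeasure {k : ℕ} (hk : 1 ≤ k) {σ : Measure ℝ≥0}
    (hσ : ∀ n : ℕ, Integrable (fun x : ℝ≥0 => (x : ℝ) ^ n) σ) (n : ℕ) :
    ∫ z, (‖z‖ ^ k) ^ n ∂(kRootMeasure k σ) = ∫ x, (x : ℝ) ^ n ∂σ := by
  have hcomp : ∀ s, (fun z : ℂ => (‖z‖ ^ k) ^ n) ∘ rootMap k s = fun x : ℝ≥0 => (x : ℝ) ^ n :=
    fun s => funext fun x => by simp only [Function.comp_apply, norm_rootMap_pow hk]
  have hi : ∀ s, Integrable (fun z : ℂ => (‖z‖ ^ k) ^ n) (σ.map (rootMap k s)) := fun s => by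
    rw [integrable_map_measure (by fun_prop) (measurable_rootMap k s).aemeasurable, hcomp]
    exact hσ n
  rw [kRootMeasure, integral_smul_measure, integral_finsetSum_measure fun s _ => hi s]
  have : ∀ s, ∫ z, (‖z‖ ^ k) ^ n ∂(σ.map (rootMap k s)) = ∫ x, (x : ℝ) ^ n ∂σ := fun s => by
    rw [integral_map (measurable_rootMap k s).aemeasurable (by fun_prop)]
    exact congrArg (integral σ) (hcomp s)
  simp only [this, Finset.sum_const, Finset.card_range, nsmul_eq_mul, smul_eq_mul]
  rw [ENNReal.toReal_inv, ENNReal.toReal_natCast, ← mul_assoc, inv_mul_cancel₀, one_mul]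
  exact_mod_cast (by omega : k ≠ 0)

end KSymmetric

/-! ### The theorem -/

theorem mainTheorem6 (k : ℕ) (hk : 1 ≤ k) (μ : Measure ℂ) (hμ : IsKSymmetric k μ)
    (hmom : HasAllMoments μ) (t : ℝ) (ht : 1 < t) :
    ∃ ν : Measure ℂ, IsKSymmetric k ν ∧ HasAllMoments ν ∧
      ∀ n : ℕ, 1 ≤ n → freeCumulant ν n = (t : ℂ) * freeCumulant μ n := by
  have := hμ.isProbabilityMeasure
  have hP := isStieltjes_mk_integral (μ := μ) (h := fun z : ℂ => ‖z‖ ^ k)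
    (fun z => by positivity) (fun n => by simpa only [← pow_mul] using hmom (k * n))
  set P := PowerSeries.mk fun n => ∫ z, (‖z‖ ^ k) ^ n ∂μ with hPdef
  have hP1 : PowerSeries.constantCoeff P = 1 := by simp [hPdef]
  obtain ⟨G, Q, hQ, hQ1, hQG, hQt⟩ := hP.exists_power hP1 hk ht
  obtain ⟨σ, hσ⟩ := hQ.exists_measure
  have hσ1 : IsProbabilityMeasure σ := by
    have h1 : ∫ _, (1 : ℝ) ∂σ = 1 := by simpa [hQ1] using (hσ 0).2
    constructor
    rw [integral_const, smul_eq_mul, mul_one] at h1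
    -- An infinite total mass would have `toReal` equal to `0`, so the zeroth moment also yields
    -- finiteness.
    exact (ENNReal.toReal_eq_one_iff _).1 h1
  have hν := isKSymmetric_kRootMeasure hk σ
  refine ⟨kRootMeasure k σ, hν, hasAllMoments_kRootMeasure hk fun n => (hσ n).1, fun n hn => ?_⟩
  refine freeCumulantOfMoments_power hk hP1 hQ1 hQG hQt (fun n => ?_) (fun n => ?_) hn
  · rw [hμ.moment_eq hk, hPdef, PowerSeries.coeff_mk]
  · rw [hν.moment_eq hk, integral_kRootMeasure hk (fun n => (hσ n).1), (hσ _).2]
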